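/- Let $\Sigma=(\Sigma_0,\Sigma_1)$ be a signature: a set $\Sigma_0$ of generating objects and a set $\Sigma_1$ of operations $d$, each with an arity and a coarity in $\Sigma_0^\star$. $\Sigma$-terms $p\to q$ (with $p,q\in\Sigma_0^\star$) are built from the operations, the identities $x\to x$ and symmetries $xy\to yx$ on generating objects and the empty term $\epsilon\to\epsilon$ by sequential composition ($;$) and parallel composition ($\otimes$). $\Sigma$-string diagrams $p\to q$ are $\Sigma$-terms modulo the laws of strict symmetric monoidal categories. A ($\Sigma$-labelled) hypergraph $G$ consists of a finite set of nodes labelled in $\Sigma_0$ and a finite set of hyperedges labelled in $\Sigma_1$, each hyperedge having a list of source nodes and a list of target nodes whose labels spell the arity and the coarity of its label. An open hypergraph $p\to q$ is a cospan $p\xrightarrow{f}G\xleftarrow{g}q$ of hypergraphs, where the words $p$ and $q$ are regarded as discrete hypergraphs; open hypergraphs are considered up to isomorphism of cospans. The interpretation $[\![-]\!]$ of string diagrams as open hypergraphs is defined inductively on terms: an operation is sent to a single hyperedge whose pairwise distinct source nodes are, in order, the inputs and whose pairwise distinct target nodes, disjoint from the sources, are, in order, the outputs; identities and symmetries are sent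 to the discrete cospans given by the identity and the swap, and the empty term to the empty cospan; parallel composition is sent to disjoint union, and sequential composition to composition of cospans by pushout. This is well defined on string diagrams. The in-degree (out-degree) of a node $v$ is the number of pairs $(h,i)$ where $h$ is a hyperedge with $v$ as its $i$-th target (source). The open hypergraph $p\xrightarrow{f}G\xleftarrow{g}q$ is monogamous if $f$ and $g$ are injective and, for every node $v$ of $G$, the in-degree of $v$ is $0$ if $v$ is in the image of $f$ and $1$ otherwise, and the out-degree of $v$ is $0$ if $v$ is in the image of $g$ and $1$ otherwise. It is acyclic if there is no nonempty directed path (each step leading from a source to a target of one hyperedge) from a node to itself. **Theorem.** An open hypergraph $p\to G\leftarrow q$ is in the image of $[\![-]\!]$ if and only if it is monogamous and acyclic. -/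

import Mathlib

namespace StringDiag

universe u v

/-! ### Signatures, terms and string diagrams -/

set_option linter.checkUnivs false in
/-- A signature: a set of generating objects and a set of operations, each with an arity and a
coarity, which are words over the generating objects. -/
structure Signature where
  Obj : Type u
  Op : Type v
  arity : Op → List Obj
  coarity : Op → List Obj

/-- Terms over `S`, built from the operations, the identities and symmetries on generating
objects and the empty diagram, by sequential and parallel composition. -/
inductive SigTerm (S : Signature.{u, v}) : List S.Obj → List S.Obj → Type (max u v)
  | op (d : S.Op) : SigTerm S (S.arity d) (S.coarity d)
  | id (x : S.Obj) : SigTerm S [x] [x]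
  | symm (x y : S.Obj) : SigTerm S [x, y] [y, x]
  | null : SigTerm S [] []
  | comp {p q r : List S.Obj} (c : SigTerm S p q) (d : SigTerm S q r) : SigTerm S p r
  | tensor {p₁ q₁ p₂ q₂ : List S.Obj} (c : SigTerm S p₁ q₁) (d : SigTerm S p₂ q₂) :
      SigTerm S (p₁ ++ p₂) (q₁ ++ q₂)

namespace SigTerm

variable {S : Signature.{u, v}}

/-- Transport of a term along equalities of words (needed because `(p ++ q) ++ r` and
`p ++ (q ++ r)` are equal, but not by definition). -/
def cast {p q p' q' : List S.Obj} (hp : p = p') (hq : q = q') (c : SigTerm S p q) :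
    SigTerm S p' q' :=
  hp ▸ hq ▸ c

/-- The identity on a word. -/
def idWord : (p : List S.Obj) → SigTerm S p p
  | [] => null
  | x :: p => tensor (id x) (idWord p)

/-- The symmetry that moves one wire `x` across a word. -/
def symmOne (x : S.Obj) : (q : List S.Obj) → SigTerm S (x :: q) (q ++ [x])
  | [] => id x
  | y :: q =>
    comp (tensor (symm x y) (idWord q) : SigTerm S ([x, y] ++ q) ([y, x] ++ q))
      (tensor (id y) (symmOne x q) : SigTerm S ([y] ++ (x :: q)) ([y] ++ (q ++ [x])))

/-- The symmetry on two words. -/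
def symmWord : (p q : List S.Obj) → SigTerm S (p ++ q) (q ++ p)
  | [], q => cast rfl (List.append_nil q).symm (idWord q)
  | x :: p, q =>
    comp (tensor (id x) (symmWord p q) : SigTerm S ([x] ++ (p ++ q)) ([x] ++ (q ++ p)))
      (cast (List.append_assoc [x] q p) (List.append_assoc q [x] p)
        (tensor (symmOne x q) (idWord p) : SigTerm S ((x :: q) ++ p) ((q ++ [x]) ++ p)))

/-- The congruence on terms that is generated by the laws of (strict) symmetric monoidal
categories. -/
inductive Equiv : {p q : List S.Obj} → SigTerm S p q → SigTerm S p q → Prop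
  | refl {p q : List S.Obj} (c : SigTerm S p q) : Equiv c c
  | symm {p q : List S.Obj} {c d : SigTerm S p q} : Equiv c d → Equiv d c
  | trans {p q : List S.Obj} {c d e : SigTerm S p q} : Equiv c d → Equiv d e → Equiv c e
  | comp_congr {p q r : List S.Obj} {c c' : SigTerm S p q} {d d' : SigTerm S q r} :
      Equiv c c' → Equiv d d' → Equiv (comp c d) (comp c' d')
  | tensor_congr {p₁ q₁ p₂ q₂ : List S.Obj} {c c' : SigTerm S p₁ q₁} {d d' : SigTerm S p₂ q₂} :
      Equiv c c' → Equiv d d' → Equiv (tensor c d) (tensor c' d')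
  | comp_assoc {p q r s : List S.Obj} (c : SigTerm S p q) (d : SigTerm S q r)
      (e : SigTerm S r s) : Equiv (comp (comp c d) e) (comp c (comp d e))
  | id_comp {p q : List S.Obj} (c : SigTerm S p q) : Equiv (comp (idWord p) c) c
  | comp_id {p q : List S.Obj} (c : SigTerm S p q) : Equiv (comp c (idWord q)) c
  | interchange {p₁ q₁ r₁ p₂ q₂ r₂ : List S.Obj} (c₁ : SigTerm S p₁ q₁) (d₁ : SigTerm S q₁ r₁)
      (c₂ : SigTerm S p₂ q₂) (d₂ : SigTerm S q₂ r₂) :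
      Equiv (comp (tensor c₁ c₂) (tensor d₁ d₂)) (tensor (comp c₁ d₁) (comp c₂ d₂))
  | tensor_assoc {p₁ q₁ p₂ q₂ p₃ q₃ : List S.Obj} (c₁ : SigTerm S p₁ q₁)
      (c₂ : SigTerm S p₂ q₂) (c₃ : SigTerm S p₃ q₃) :
      Equiv (cast (List.append_assoc p₁ p₂ p₃) (List.append_assoc q₁ q₂ q₃)
        (tensor (tensor c₁ c₂) c₃)) (tensor c₁ (tensor c₂ c₃))
  | null_tensor {p q : List S.Obj} (c : SigTerm S p q) : Equiv (tensor null c) c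
  | tensor_null {p q : List S.Obj} (c : SigTerm S p q) :
      Equiv (cast (List.append_nil p) (List.append_nil q) (tensor c null)) c
  | symm_natural (r : List S.Obj) {p q : List S.Obj} (c : SigTerm S p q) :
      Equiv (comp (tensor (idWord r) c) (symmWord r q))
        (comp (symmWord r p) (tensor c (idWord r)))
  | symm_symm (p q : List S.Obj) :
      Equiv (comp (symmWord p q) (symmWord q p)) (idWord (p ++ q))

/-- Equality modulo the laws of symmetric monoidal categories, as a setoid. -/
def setoid (S : Signature.{u, v}) (p q : List S.Obj) : Setoid (SigTerm S p q) where
  r := Equiv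
  iseqv := ⟨Equiv.refl, Equiv.symm, Equiv.trans⟩

end SigTerm

/-- String diagrams over `S` of type `p → q`: terms modulo the laws of symmetric monoidal
categories, i.e. the morphisms `p → q` of the free symmetric monoidal category on `S`. -/
def StringDiagram (S : Signature.{u, v}) (p q : List S.Obj) : Type (max u v) :=
  Quotient (SigTerm.setoid S p q)

/-! ### Open hypergraphs -/

/-- Finite hypergraphs labelled over `S`: every hyperedge has a list of sources and a list of
targets, and the labels of these nodes are the arity and the coarity of its label. -/
structure Hypergraph (S : Signature.{u, v}) where
  Node : Type
  Edge : Type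
  finite_node : Finite Node
  finite_edge : Finite Edge
  nodeLabel : Node → S.Obj
  edgeLabel : Edge → S.Op
  source : Edge → List Node
  target : Edge → List Node
  source_label : ∀ e, (source e).map nodeLabel = S.arity (edgeLabel e)
  target_label : ∀ e, (target e).map nodeLabel = S.coarity (edgeLabel e)

/-- Open hypergraphs of type `p → q`, i.e. cospans `p → G ← q` of hypergraphs, where the words
`p` and `q` stand for discrete hypergraphs with nodes `0, …, p.length - 1`, labelled by the letters
of `p` (resp. `q`). A homomorphism from the discrete hypergraph `p` to `G` is the same thing as a
list of nodes of `G` whose list of labels is `p`; its underlying function is `inputs.get`. -/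
structure OpenHypergraph (S : Signature.{u, v}) (p q : List S.Obj) extends Hypergraph S where
  inputs : List Node
  outputs : List Node
  inputs_label : inputs.map nodeLabel = p
  outputs_label : outputs.map nodeLabel = q

/-- The in-degree of a node `x`: the number of pairs `(h, i)` such that `x` is the `i`-th target
of the hyperedge `h`. -/
noncomputable def Hypergraph.inDegree {S : Signature.{u, v}} (G : Hypergraph S) (x : G.Node) :
    ℕ :=
  Set.ncard {a : G.Edge × ℕ | (G.target a.1)[a.2]? = some x}

/-- The out-degree of a node `x`: the number of pairs `(h, i)` such that `x` is the `i`-th source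
of the hyperedge `h`. -/
noncomputable def Hypergraph.outDegree {S : Signature.{u, v}} (G : Hypergraph S) (x : G.Node) :
    ℕ :=
  Set.ncard {a : G.Edge × ℕ | (G.source a.1)[a.2]? = some x}

/-- There is a hyperedge with `x` among its sources and `y` among its targets. -/
def Hypergraph.Step {S : Signature.{u, v}} (G : Hypergraph S) (x y : G.Node) : Prop :=
  ∃ e : G.Edge, x ∈ G.source e ∧ y ∈ G.target e

/-- No nonempty directed path leads from a node to itself. -/
def Hypergraph.Acyclic {S : Signature.{u, v}} (G : Hypergraph S) : Prop :=
  ∀ x : G.Node, ¬ Relation.TransGen G.Step x x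

namespace OpenHypergraph

variable {S : Signature.{u, v}}

/-- Monogamy of an open hypergraph. -/
structure Monogamous {p q : List S.Obj} (G : OpenHypergraph S p q) : Prop where
  inputs_injective : Function.Injective G.inputs.get
  outputs_injective : Function.Injective G.outputs.get
  inDegree_of_mem : ∀ x ∈ Set.range G.inputs.get, G.inDegree x = 0
  inDegree_of_not_mem : ∀ x ∉ Set.range G.inputs.get, G.inDegree x = 1
  outDegree_of_mem : ∀ x ∈ Set.range G.outputs.get, G.outDegree x = 0
  outDegree_of_not_mem : ∀ x ∉ Set.range G.outputs.get, G.outDegree x = 1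

/-- Isomorphism of open hypergraphs (of cospans): an isomorphism of labelled hypergraphs that
commutes with the interface maps. -/
def Iso {p q p' q' : List S.Obj} (G : OpenHypergraph S p q) (H : OpenHypergraph S p' q') : Prop :=
  ∃ (φ : G.Node ≃ H.Node) (ψ : G.Edge ≃ H.Edge),
    (∀ x, H.nodeLabel (φ x) = G.nodeLabel x) ∧
    (∀ e, H.edgeLabel (ψ e) = G.edgeLabel e) ∧
    (∀ e, H.source (ψ e) = (G.source e).map φ) ∧
    (∀ e, H.target (ψ e) = (G.target e).map φ) ∧
    H.inputs = G.inputs.map φ ∧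
    H.outputs = G.outputs.map φ

/-- An operation as an open hypergraph: a single hyperedge, whose sources are the inputs and whose
targets are the outputs. -/
def ofOp (d : S.Op) : OpenHypergraph S (S.arity d) (S.coarity d) where
  Node := Fin (S.arity d).length ⊕ Fin (S.coarity d).length
  Edge := Unit
  finite_node := inferInstance
  finite_edge := inferInstance
  nodeLabel := Sum.elim (S.arity d).get (S.coarity d).get
  edgeLabel _ := d
  source _ := (List.finRange _).map Sum.inl
  target _ := (List.finRange _).map Sum.inr
  source_label _ := by simp
  target_label _ := by simp
  inputs := (List.finRange _).map Sum.inl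
  outputs := (List.finRange _).map Sum.inr
  inputs_label := by simp
  outputs_label := by simp

/-- The identity on a generating object: one node, which is both input and output. -/
def ofId (x : S.Obj) : OpenHypergraph S [x] [x] where
  Node := Unit
  Edge := Empty
  finite_node := inferInstance
  finite_edge := inferInstance
  nodeLabel _ := x
  edgeLabel := Empty.elim
  source := Empty.elim
  target := Empty.elim
  source_label e := e.elim
  target_label e := e.elim
  inputs := [()]
  outputs := [()]
  inputs_label := rfl
  outputs_label := rfl

/-- The symmetry on two generating objects: two nodes, which are inputs and, in the opposite
order, outputs. -/
def ofSymm (x y : S.Obj) : OpenHypergraph S [x, y] [y, x] where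
  Node := Bool
  Edge := Empty
  finite_node := inferInstance
  finite_edge := inferInstance
  nodeLabel b := bif b then y else x
  edgeLabel := Empty.elim
  source := Empty.elim
  target := Empty.elim
  source_label e := e.elim
  target_label e := e.elim
  inputs := [false, true]
  outputs := [true, false]
  inputs_label := rfl
  outputs_label := rfl

/-- The empty open hypergraph. -/
def ofNull : OpenHypergraph S [] [] where
  Node := Empty
  Edge := Empty
  finite_node := inferInstance
  finite_edge := inferInstance
  nodeLabel := Empty.elim
  edgeLabel := Empty.elim
  source := Empty.elim
  target := Empty.elim
  source_label e := e.elim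
  target_label e := e.elim
  inputs := []
  outputs := []
  inputs_label := rfl
  outputs_label := rfl

/-- Parallel composition: the disjoint union of the hypergraphs and of the interfaces. -/
def tensor {p₁ q₁ p₂ q₂ : List S.Obj} (G : OpenHypergraph S p₁ q₁) (H : OpenHypergraph S p₂ q₂) :
    OpenHypergraph S (p₁ ++ p₂) (q₁ ++ q₂) where
  Node := G.Node ⊕ H.Node
  Edge := G.Edge ⊕ H.Edge
  finite_node := by
    have := G.finite_node
    have := H.finite_node
    infer_instance
  finite_edge := by
    have := G.finite_edge
    have := H.finite_edge
    infer_instance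
  nodeLabel := Sum.elim G.nodeLabel H.nodeLabel
  edgeLabel := Sum.elim G.edgeLabel H.edgeLabel
  source := Sum.elim (fun e => (G.source e).map Sum.inl) (fun e => (H.source e).map Sum.inr)
  target := Sum.elim (fun e => (G.target e).map Sum.inl) (fun e => (H.target e).map Sum.inr)
  source_label e := by
    cases e
    · simpa using G.source_label _
    · simpa using H.source_label _
  target_label e := by
    cases e
    · simpa using G.target_label _
    · simpa using H.target_label _
  inputs := G.inputs.map Sum.inl ++ H.inputs.map Sum.inr
  outputs := G.outputs.map Sum.inl ++ H.outputs.map Sum.inr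
  inputs_label := by simp [G.inputs_label, H.inputs_label]
  outputs_label := by simp [G.outputs_label, H.outputs_label]

/-- In a sequential composite, the `i`-th output of `G` is glued to the `i`-th input of `H`. -/
inductive Glue {p q r : List S.Obj} (G : OpenHypergraph S p q) (H : OpenHypergraph S q r) :
    G.Node ⊕ H.Node → G.Node ⊕ H.Node → Prop
  | mk (x : G.Node) (y : H.Node) : (x, y) ∈ G.outputs.zip H.inputs → Glue G H (.inl x) (.inr y)

theorem label_eq_of_glue {p q r : List S.Obj} (G : OpenHypergraph S p q)
    (H : OpenHypergraph S q r) {a b : G.Node ⊕ H.Node} (h : Glue G H a b) :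
    Sum.elim G.nodeLabel H.nodeLabel a = Sum.elim G.nodeLabel H.nodeLabel b := by
  obtain ⟨x, y, hxy⟩ := h
  obtain ⟨i, hi, hxy⟩ := List.mem_iff_getElem.1 hxy
  have h1 : G.outputs.map G.nodeLabel = H.inputs.map H.nodeLabel :=
    G.outputs_label.trans H.inputs_label.symm
  simp only [List.getElem_zip, Prod.mk.injEq] at hxy
  have h3 := congrArg (fun l => l[i]?) h1
  simp only [List.length_zip, lt_inf_iff] at hi
  simp only [List.getElem?_map, List.getElem?_eq_getElem hi.1, List.getElem?_eq_getElem hi.2,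
    hxy.1, hxy.2] at h3
  simpa using h3

/-- Sequential composition, i.e. composition of cospans by pushout of hypergraphs: the disjoint
union of the hypergraphs, where the outputs of `G` are identified with the inputs of `H` (`Quot`
is the quotient by the equivalence relation that `Glue` generates). -/
def comp {p q r : List S.Obj} (G : OpenHypergraph S p q) (H : OpenHypergraph S q r) :
    OpenHypergraph S p r where
  Node := Quot (Glue G H)
  Edge := G.Edge ⊕ H.Edge
  finite_node := by
    have := G.finite_node
    have := H.finite_node
    infer_instance
  finite_edge := by
    have := G.finite_edge
    have := H.finite_edge
    infer_instance
  nodeLabel := Quot.lift (Sum.elim G.nodeLabel H.nodeLabel) fun _ _ => label_eq_of_glue G H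
  edgeLabel := Sum.elim G.edgeLabel H.edgeLabel
  source := Sum.elim (fun e => (G.source e).map fun x => Quot.mk _ (.inl x))
    (fun e => (H.source e).map fun x => Quot.mk _ (.inr x))
  target := Sum.elim (fun e => (G.target e).map fun x => Quot.mk _ (.inl x))
    (fun e => (H.target e).map fun x => Quot.mk _ (.inr x))
  source_label e := by
    cases e
    · simpa [Function.comp_def] using G.source_label _
    · simpa [Function.comp_def] using H.source_label _
  target_label e := by
    cases e
    · simpa [Function.comp_def] using G.target_label _
    · simpa [Function.comp_def] using H.target_label _
  inputs := G.inputs.map fun x => Quot.mk _ (.inl x)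
  outputs := H.outputs.map fun x => Quot.mk _ (.inr x)
  inputs_label := by simpa [Function.comp_def] using G.inputs_label
  outputs_label := by simpa [Function.comp_def] using H.outputs_label

/-! Isomorphism is an equivalence relation, compatible with the two compositions. -/

theorem Iso.refl {p q : List S.Obj} (G : OpenHypergraph S p q) : Iso G G :=
  ⟨Equiv.refl _, Equiv.refl _, by simp⟩

theorem Iso.symm {p q p' q' : List S.Obj} {G : OpenHypergraph S p q} {H : OpenHypergraph S p' q'}
    (h : Iso G H) : Iso H G := by
  obtain ⟨φ, ψ, h1, h2, h3, h4, h5, h6⟩ := h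
  refine ⟨φ.symm, ψ.symm, fun x => ?_, fun e => ?_, fun e => ?_, fun e => ?_, ?_, ?_⟩
  · rw [← h1, φ.apply_symm_apply]
  · rw [← h2, ψ.apply_symm_apply]
  · conv_rhs => rw [← ψ.apply_symm_apply e, h3]
    simp
  · conv_rhs => rw [← ψ.apply_symm_apply e, h4]
    simp
  · simp [h5]
  · simp [h6]

theorem Iso.trans {p q p' q' p'' q'' : List S.Obj} {G : OpenHypergraph S p q}
    {H : OpenHypergraph S p' q'} {K : OpenHypergraph S p'' q''}
    (h : Iso G H) (h' : Iso H K) : Iso G K := by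
  obtain ⟨φ, ψ, h1, h2, h3, h4, h5, h6⟩ := h
  obtain ⟨φ', ψ', h1', h2', h3', h4', h5', h6'⟩ := h'
  exact ⟨φ.trans φ', ψ.trans ψ', by simp [h1, h1'], by simp [h2, h2'], by simp [h3, h3'],
    by simp [h4, h4'], by simp [h5, h5'], by simp [h6, h6']⟩

theorem map_square {α β γ δ : Type*} {f : α → β} {g : β → γ} {f' : α → δ} {g' : δ → γ}
    {l : List α} {m : List β} (hm : m = l.map f) (h : ∀ x, g (f x) = g' (f' x)) :
    m.map g = (l.map f').map g' := by
  simp [hm, h]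

theorem map_square_append {α β α₁ β₁ γ δ : Type*} {f : α → β} {g : β → γ} {f' : α → δ}
    {g' : δ → γ} {f₁ : α₁ → β₁} {g₁ : β₁ → γ} {f₁' : α₁ → δ} {l : List α} {m : List β}
    {l₁ : List α₁} {m₁ : List β₁} (hm : m = l.map f) (hm₁ : m₁ = l₁.map f₁)
    (h : ∀ x, g (f x) = g' (f' x)) (h₁ : ∀ x, g₁ (f₁ x) = g' (f₁' x)) :
    m.map g ++ m₁.map g₁ = (l.map f' ++ l₁.map f₁').map g' := by
  rw [List.map_append, map_square hm h, map_square hm₁ h₁]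

theorem Iso.tensor {p₁ q₁ p₂ q₂ : List S.Obj} {G G' : OpenHypergraph S p₁ q₁}
    {H H' : OpenHypergraph S p₂ q₂} (h : Iso G G') (h' : Iso H H') :
    Iso (G.tensor H) (G'.tensor H') := by
  obtain ⟨φ, ψ, h1, h2, h3, h4, h5, h6⟩ := h
  obtain ⟨φ', ψ', h1', h2', h3', h4', h5', h6'⟩ := h'
  refine ⟨Equiv.sumCongr φ φ', Equiv.sumCongr ψ ψ', ?_, ?_, ?_, ?_, ?_, ?_⟩
  · rintro (x | x)
    exacts [h1 x, h1' x]
  · rintro (x | x)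
    exacts [h2 x, h2' x]
  · rintro (x | x)
    exacts [map_square (h3 x) fun _ => rfl, map_square (h3' x) fun _ => rfl]
  · rintro (x | x)
    exacts [map_square (h4 x) fun _ => rfl, map_square (h4' x) fun _ => rfl]
  · exact map_square_append h5 h5' (fun _ => rfl) fun _ => rfl
  · exact map_square_append h6 h6' (fun _ => rfl) fun _ => rfl

theorem mem_zip_map {α β γ δ : Type*} (f : α → γ) (g : β → δ) {l : List α} {m : List β} {x : α}
    {y : β} (h : (x, y) ∈ l.zip m) : (f x, g y) ∈ (l.map f).zip (m.map g) := by
  rw [List.zip_map]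
  exact List.mem_map_of_mem h

theorem Iso.comp {p q r p' q' r' : List S.Obj} {G : OpenHypergraph S p q}
    {G' : OpenHypergraph S p' q'} {H : OpenHypergraph S q r} {H' : OpenHypergraph S q' r'}
    (h : Iso G G') (h' : Iso H H') :
    Iso (G.comp H) (G'.comp H') := by
  obtain ⟨φ, ψ, h1, h2, h3, h4, h5, h6⟩ := h
  obtain ⟨φ', ψ', h1', h2', h3', h4', h5', h6'⟩ := h'
  refine ⟨Quot.congr (Equiv.sumCongr φ φ') ?_, Equiv.sumCongr ψ ψ', ?_, ?_, ?_, ?_, ?_, ?_⟩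
  · intro a b
    constructor
    · rintro ⟨x, y, hxy⟩
      refine Glue.mk _ _ ?_
      rw [h6, h5']
      exact mem_zip_map _ _ hxy
    · intro hab
      generalize ha' : Equiv.sumCongr φ φ' a = a' at hab
      generalize hb' : Equiv.sumCongr φ φ' b = b' at hab
      obtain ⟨x, y, hxy⟩ := hab
      obtain rfl : a = .inl (φ.symm x) := by
        rw [← Equiv.eq_symm_apply] at ha'; simpa using ha'
      obtain rfl : b = .inr (φ'.symm y) := by
        rw [← Equiv.eq_symm_apply] at hb'; simpa using hb'
      refine Glue.mk _ _ ?_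
      have := mem_zip_map φ.symm φ'.symm hxy
      simpa [h6, h5'] using this
  · rintro ⟨x | x⟩
    · exact h1 x
    · exact h1' x
  · rintro (x | x)
    exacts [h2 x, h2' x]
  · rintro (x | x)
    exacts [map_square (h3 x) fun _ => rfl, map_square (h3' x) fun _ => rfl]
  · rintro (x | x)
    exacts [map_square (h4 x) fun _ => rfl, map_square (h4' x) fun _ => rfl]
  · exact map_square h5 fun _ => rfl
  · exact map_square h6' fun _ => rfl

/-! The laws of symmetric monoidal categories hold up to isomorphism. -/

theorem mem_zip_map_iff {α β γ δ : Type*} {f : α → γ} {g : β → δ} {l : List α} {m : List β}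
    {x : γ} {y : δ} :
    (x, y) ∈ (l.map f).zip (m.map g) ↔ ∃ a b, (a, b) ∈ l.zip m ∧ f a = x ∧ g b = y := by
  rw [List.zip_map]
  simp

theorem map_eq_map {α β γ : Type*} {f : α → γ} {g : α → β} {h : β → γ} {l : List α}
    (hh : ∀ x, f x = h (g x)) : l.map f = (l.map g).map h := by
  simp [hh]

theorem map_eq_map_map {α β γ δ : Type*} {f : α → δ} {g : α → β} {h : β → γ} {k : γ → δ}
    {l : List α} (hh : ∀ x, f x = k (h (g x))) : l.map f = ((l.map g).map h).map k := by
  simp [hh]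

theorem map_map_eq_map {α β γ ε : Type*} {f : α → ε} {f' : ε → γ} {g : α → β} {h : β → γ}
    {l : List α} (hh : ∀ x, f' (f x) = h (g x)) : (l.map f).map f' = (l.map g).map h := by
  simp [hh]

theorem map_map_eq_map_map {α β γ δ ε : Type*} {f : α → ε} {f' : ε → δ} {g : α → β} {h : β → γ}
    {k : γ → δ} {l : List α} (hh : ∀ x, f' (f x) = k (h (g x))) :
    (l.map f).map f' = ((l.map g).map h).map k := by
  simp [hh]

theorem interchange_lists {α α' β β' γ ε ζ : Type*} {a : α → β} {b : β → ζ} {a' : α' → β'}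
    {b' : β' → ζ} {c : α → γ} {d : α' → γ} {e : γ → ε} {k : ε → ζ} {l : List α} {m : List α'}
    (h : ∀ x, b (a x) = k (e (c x))) (h' : ∀ x, b' (a' x) = k (e (d x))) :
    (l.map a).map b ++ (m.map a').map b' = ((l.map c ++ m.map d).map e).map k := by
  rw [List.map_append, List.map_append, map_map_eq_map_map h, map_map_eq_map_map h']

theorem assoc_lists {α₁ α₂ α₃ β γ δ ε : Type*} {a : α₁ → β} {b : α₂ → γ} {c : α₃ → γ} {d : γ → β}
    {e : α₁ → δ} {f : α₂ → δ} {g : δ → ε} {h : α₃ → ε} {i : ε → β} {l : List α₁} {m : List α₂}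
    {k : List α₃} (h₁ : ∀ x, a x = i (g (e x))) (h₂ : ∀ x, d (b x) = i (g (f x)))
    (h₃ : ∀ x, d (c x) = i (h x)) :
    l.map a ++ (m.map b ++ k.map c).map d =
      ((l.map e ++ m.map f).map g ++ k.map h).map i := by
  simp only [List.map_append, List.append_assoc]
  rw [map_eq_map_map h₁, map_map_eq_map_map h₂, map_map_eq_map h₃]

theorem eq_map_map {α β : Type*} {f : α → β} {g : β → α} {l : List α} (h : ∀ x, x = g (f x)) :
    l = (l.map f).map g :=
  (List.map_id _).symm.trans (map_eq_map h)

theorem length_outputs {p q : List S.Obj} (G : OpenHypergraph S p q) :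
    G.outputs.length = q.length := by
  simpa using congrArg List.length G.outputs_label

theorem length_inputs {p q : List S.Obj} (G : OpenHypergraph S p q) :
    G.inputs.length = p.length := by
  simpa using congrArg List.length G.inputs_label

/-- The inclusion of the nodes of `G` into those of `G.comp H`. -/
def compInl {p q r : List S.Obj} (G : OpenHypergraph S p q) (H : OpenHypergraph S q r)
    (x : G.Node) : (G.comp H).Node :=
  Quot.mk _ (.inl x)

/-- The inclusion of the nodes of `H` into those of `G.comp H`. -/
def compInr {p q r : List S.Obj} (G : OpenHypergraph S p q) (H : OpenHypergraph S q r)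
    (y : H.Node) : (G.comp H).Node :=
  Quot.mk _ (.inr y)

theorem compGlue {p q r : List S.Obj} {G : OpenHypergraph S p q} {H : OpenHypergraph S q r}
    {x : G.Node} {y : H.Node} (h : (x, y) ∈ G.outputs.zip H.inputs) :
    compInl G H x = compInr G H y :=
  Quot.sound (Glue.mk x y h)

/-- The universal property of the nodes of `G.comp H`. -/
def compDesc {p q r : List S.Obj} {G : OpenHypergraph S p q} {H : OpenHypergraph S q r}
    {α : Type} (f : G.Node → α) (g : H.Node → α)
    (h : ∀ x y, (x, y) ∈ G.outputs.zip H.inputs → f x = g y) : (G.comp H).Node → α :=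
  Quot.lift (Sum.elim f g) (by rintro _ _ ⟨x, y, hxy⟩; exact h x y hxy)

theorem comp_cases {p q r : List S.Obj} {G : OpenHypergraph S p q} {H : OpenHypergraph S q r}
    {P : (G.comp H).Node → Prop} (h1 : ∀ x, P (compInl G H x)) (h2 : ∀ y, P (compInr G H y))
    (a : (G.comp H).Node) : P a := by
  induction a using Quot.ind with
  | mk a => exact a.casesOn h1 h2

theorem comp_assoc_iso {p q r s : List S.Obj} (G : OpenHypergraph S p q)
    (H : OpenHypergraph S q r) (K : OpenHypergraph S r s) :
    Iso ((G.comp H).comp K) (G.comp (H.comp K)) := by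
  let f : ((G.comp H).comp K).Node → (G.comp (H.comp K)).Node :=
    compDesc (compDesc (fun x => compInl _ _ x) (fun y => compInr _ _ (compInl _ _ y)) (by
        intro x y h
        have := mem_zip_map id (fun y => compInl H K y) h
        rw [List.map_id] at this
        exact compGlue this))
      (fun z => compInr _ _ (compInr _ _ z)) (by
        intro x z h
        have h' : (x, z) ∈ (H.outputs.map (compInr G H)).zip (K.inputs.map id) := by
          rw [List.map_id]; exact h
        obtain ⟨y, z, hyz, rfl, rfl⟩ := mem_zip_map_iff.1 h'
        exact congrArg (compInr G (H.comp K)) (compGlue hyz))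
  let g : (G.comp (H.comp K)).Node → ((G.comp H).comp K).Node :=
    compDesc (fun x => compInl _ _ (compInl _ _ x))
      (compDesc (fun y => compInl _ _ (compInr _ _ y)) (fun z => compInr _ _ z) (by
        intro y z h
        have := mem_zip_map (fun y => compInr G H y) id h
        rw [List.map_id] at this
        exact compGlue this)) (by
        intro x z h
        have h' : (x, z) ∈ (G.outputs.map id).zip (H.inputs.map (compInl H K)) := by
          rw [List.map_id]; exact h
        obtain ⟨x, y, hxy, rfl, rfl⟩ := mem_zip_map_iff.1 h'
        exact congrArg (compInl (G.comp H) K) (compGlue hxy))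
  refine ⟨⟨f, g, ?_, ?_⟩, Equiv.sumAssoc _ _ _, ?_, ?_, ?_, ?_, ?_, ?_⟩
  · exact comp_cases (comp_cases (fun _ => rfl) fun _ => rfl) fun _ => rfl
  · exact comp_cases (fun _ => rfl) (comp_cases (fun _ => rfl) fun _ => rfl)
  · exact comp_cases (comp_cases (fun _ => rfl) fun _ => rfl) fun _ => rfl
  · rintro ((x | x) | x) <;> rfl
  · rintro ((x | x) | x)
    · exact map_eq_map_map (l := G.source x) fun _ => rfl
    · exact map_map_eq_map_map (l := H.source x) fun _ => rfl
    · exact map_map_eq_map (l := K.source x) fun _ => rfl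
  · rintro ((x | x) | x)
    · exact map_eq_map_map (l := G.target x) fun _ => rfl
    · exact map_map_eq_map_map (l := H.target x) fun _ => rfl
    · exact map_map_eq_map (l := K.target x) fun _ => rfl
  · exact map_eq_map_map (l := G.inputs) fun _ => rfl
  · exact map_map_eq_map (l := K.outputs) fun _ => rfl

theorem interchange_iso {p₁ q₁ r₁ p₂ q₂ r₂ : List S.Obj} (G : OpenHypergraph S p₁ q₁)
    (H : OpenHypergraph S q₁ r₁) (G' : OpenHypergraph S p₂ q₂) (H' : OpenHypergraph S q₂ r₂) :
    Iso ((G.tensor G').comp (H.tensor H')) ((G.comp H).tensor (G'.comp H')) := by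
  have hlen : (G.outputs.map (Sum.inl : _ → G.Node ⊕ G'.Node)).length =
      (H.inputs.map (Sum.inl : _ → H.Node ⊕ H'.Node)).length := by
    simp [length_outputs, length_inputs]
  have hzip : ∀ (x : G.Node ⊕ G'.Node) (y : H.Node ⊕ H'.Node),
      (x, y) ∈ (G.outputs.map Sum.inl ++ G'.outputs.map Sum.inr).zip
        (H.inputs.map Sum.inl ++ H'.inputs.map Sum.inr) ↔
      (∃ a b, (a, b) ∈ G.outputs.zip H.inputs ∧ Sum.inl a = x ∧ Sum.inl b = y) ∨
      (∃ a b, (a, b) ∈ G'.outputs.zip H'.inputs ∧ Sum.inr a = x ∧ Sum.inr b = y) := by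
    intro x y
    rw [List.zip_append hlen, List.mem_append, mem_zip_map_iff, mem_zip_map_iff]
  let f : ((G.tensor G').comp (H.tensor H')).Node → ((G.comp H).tensor (G'.comp H')).Node :=
    compDesc (Sum.map (compInl G H) (compInl G' H')) (Sum.map (compInr G H) (compInr G' H')) (by
      intro x y h
      rcases (hzip x y).1 h with ⟨a, b, hab, rfl, rfl⟩ | ⟨a, b, hab, rfl, rfl⟩
      · exact congrArg Sum.inl (compGlue hab)
      · exact congrArg Sum.inr (compGlue hab))
  let g : ((G.comp H).tensor (G'.comp H')).Node → ((G.tensor G').comp (H.tensor H')).Node :=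
    Sum.elim
      (compDesc (fun x => compInl (G.tensor G') (H.tensor H') (.inl x))
        (fun x => compInr (G.tensor G') (H.tensor H') (.inl x))
        fun x y h => compGlue ((hzip _ _).2 (.inl ⟨x, y, h, rfl, rfl⟩)))
      (compDesc (fun x => compInl (G.tensor G') (H.tensor H') (.inr x))
        (fun x => compInr (G.tensor G') (H.tensor H') (.inr x))
        fun x y h => compGlue ((hzip _ _).2 (.inr ⟨x, y, h, rfl, rfl⟩)))
  refine ⟨⟨f, g, ?_, ?_⟩, Equiv.sumSumSumComm _ _ _ _, ?_, ?_, ?_, ?_, ?_, ?_⟩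
  · refine comp_cases ?_ ?_ <;> rintro (x | x) <;> rfl
  · rintro (x | x) <;> revert x <;> exact comp_cases (fun _ => rfl) fun _ => rfl
  · refine comp_cases ?_ ?_ <;> rintro (x | x) <;> rfl
  · rintro ((x | x) | (x | x)) <;> rfl
  · rintro ((x | x) | (x | x))
    · exact map_map_eq_map_map (l := G.source x) fun _ => rfl
    · exact map_map_eq_map_map (l := G'.source x) fun _ => rfl
    · exact map_map_eq_map_map (l := H.source x) fun _ => rfl
    · exact map_map_eq_map_map (l := H'.source x) fun _ => rfl
  · rintro ((x | x) | (x | x))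
    · exact map_map_eq_map_map (l := G.target x) fun _ => rfl
    · exact map_map_eq_map_map (l := G'.target x) fun _ => rfl
    · exact map_map_eq_map_map (l := H.target x) fun _ => rfl
    · exact map_map_eq_map_map (l := H'.target x) fun _ => rfl
  · exact interchange_lists (l := G.inputs) (m := G'.inputs) (fun _ => rfl) fun _ => rfl
  · exact interchange_lists (l := H.outputs) (m := H'.outputs) (fun _ => rfl) fun _ => rfl

theorem tensor_assoc_iso {p₁ q₁ p₂ q₂ p₃ q₃ : List S.Obj} (G : OpenHypergraph S p₁ q₁)
    (H : OpenHypergraph S p₂ q₂) (K : OpenHypergraph S p₃ q₃) :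
    Iso ((G.tensor H).tensor K) (G.tensor (H.tensor K)) := by
  refine ⟨Equiv.sumAssoc _ _ _, Equiv.sumAssoc _ _ _, ?_, ?_, ?_, ?_, ?_, ?_⟩
  · rintro ((x | x) | x) <;> rfl
  · rintro ((x | x) | x) <;> rfl
  · rintro ((x | x) | x)
    · exact map_eq_map_map (l := G.source x) fun _ => rfl
    · exact map_map_eq_map_map (l := H.source x) fun _ => rfl
    · exact map_map_eq_map (l := K.source x) fun _ => rfl
  · rintro ((x | x) | x)
    · exact map_eq_map_map (l := G.target x) fun _ => rfl
    · exact map_map_eq_map_map (l := H.target x) fun _ => rfl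
    · exact map_map_eq_map (l := K.target x) fun _ => rfl
  · exact assoc_lists (l := G.inputs) (m := H.inputs) (fun _ => rfl) (fun _ => rfl) fun _ => rfl
  · exact assoc_lists (l := G.outputs) (m := H.outputs) (fun _ => rfl) (fun _ => rfl) fun _ => rfl

theorem null_tensor_iso {p q : List S.Obj} (G : OpenHypergraph S p q) :
    Iso (ofNull.tensor G) G := by
  refine ⟨⟨Sum.elim Empty.elim id, Sum.inr, ?_, ?_⟩, ⟨Sum.elim Empty.elim id, Sum.inr, ?_, ?_⟩,
    ?_, ?_, ?_, ?_, ?_, ?_⟩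
  · rintro (⟨⟨⟩⟩ | x); rfl
  · intro x; rfl
  · rintro (⟨⟨⟩⟩ | x); rfl
  · intro x; rfl
  · rintro (⟨⟨⟩⟩ | x); rfl
  · rintro (⟨⟨⟩⟩ | x); rfl
  · rintro (⟨⟨⟩⟩ | x)
    exact eq_map_map (l := G.source x) fun _ => rfl
  · rintro (⟨⟨⟩⟩ | x)
    exact eq_map_map (l := G.target x) fun _ => rfl
  · exact eq_map_map (l := G.inputs) fun _ => rfl
  · exact eq_map_map (l := G.outputs) fun _ => rfl

theorem tensor_null_iso {p q : List S.Obj} (G : OpenHypergraph S p q) :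
    Iso (G.tensor ofNull) G := by
  refine ⟨⟨Sum.elim id Empty.elim, Sum.inl, ?_, ?_⟩, ⟨Sum.elim id Empty.elim, Sum.inl, ?_, ?_⟩,
    ?_, ?_, ?_, ?_, ?_, ?_⟩
  · rintro (x | ⟨⟨⟩⟩); rfl
  · intro x; rfl
  · rintro (x | ⟨⟨⟩⟩); rfl
  · intro x; rfl
  · rintro (x | ⟨⟨⟩⟩); rfl
  · rintro (x | ⟨⟨⟩⟩); rfl
  · rintro (x | ⟨⟨⟩⟩)
    exact eq_map_map (l := G.source x) fun _ => rfl
  · rintro (x | ⟨⟨⟩⟩)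
    exact eq_map_map (l := G.target x) fun _ => rfl
  · exact (eq_map_map (l := G.inputs) fun _ => rfl).trans
      (congrArg (List.map _) (List.append_nil _).symm)
  · exact (eq_map_map (l := G.outputs) fun _ => rfl).trans
      (congrArg (List.map _) (List.append_nil _).symm)

/-- `G` with its outputs replaced by the list `l`. -/
def withOutputs {p q : List S.Obj} (G : OpenHypergraph S p q) (l : List G.Node) :
    OpenHypergraph S p (l.map G.nodeLabel) :=
  { G with outputs := l, outputs_label := rfl }

/-- `G` with its inputs replaced by the list `l`. -/
def withInputs {p q : List S.Obj} (G : OpenHypergraph S p q) (l : List G.Node) :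
    OpenHypergraph S (l.map G.nodeLabel) q :=
  { G with inputs := l, inputs_label := rfl }

theorem mem_zip_map_left {α β : Type*} (φ : α → β) {l : List α} {a : α} {b : β} :
    (b, a) ∈ (l.map φ).zip l ↔ a ∈ l ∧ b = φ a := by
  induction l with
  | nil => simp
  | cons c l ih =>
    simp only [List.map_cons, List.zip_cons_cons, List.mem_cons, Prod.mk.injEq, ih]
    constructor
    · rintro (⟨rfl, rfl⟩ | ⟨h, rfl⟩) <;> simp [*]
    · rintro ⟨rfl | h, rfl⟩ <;> simp [*]

theorem mem_zip_map_right {α β : Type*} (φ : α → β) {l : List α} {a : α} {b : β} :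
    (a, b) ∈ l.zip (l.map φ) ↔ a ∈ l ∧ b = φ a := by
  induction l with
  | nil => simp
  | cons c l ih =>
    simp only [List.map_cons, List.zip_cons_cons, List.mem_cons, Prod.mk.injEq, ih]
    constructor
    · rintro (⟨rfl, rfl⟩ | ⟨h, rfl⟩) <;> simp [*]
    · rintro ⟨rfl | h, rfl⟩ <;> simp [*]

/-- Composing on the right with a hypergraph without hyperedges, all of whose nodes are inputs,
only changes the outputs. -/
theorem comp_iso_withOutputs {p q r : List S.Obj} (G : OpenHypergraph S p q)
    (D : OpenHypergraph S q r) (he : IsEmpty D.Edge) (hD : ∀ n, n ∈ D.inputs)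
    (φ : D.Node → G.Node) (hφ : D.inputs.map φ = G.outputs) :
    Iso (G.comp D) (G.withOutputs (D.outputs.map φ)) := by
  have hz : ∀ x n, (x, n) ∈ G.outputs.zip D.inputs ↔ x = φ n := by
    intro x n
    rw [← hφ, mem_zip_map_left]
    simp [hD]
  refine ⟨⟨compDesc id φ fun x n => (hz x n).1, compInl G D, ?_, fun _ => rfl⟩,
    Equiv.sumEmpty _ _, ?_, ?_, ?_, ?_, ?_, ?_⟩
  · exact comp_cases (fun _ => rfl) fun n => compGlue ((hz _ n).2 rfl)
  · exact comp_cases (fun _ => rfl) fun n =>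
      label_eq_of_glue G D (Glue.mk _ _ ((hz _ n).2 rfl))
  · rintro (x | x)
    exacts [rfl, isEmptyElim x]
  · rintro (x | x)
    exacts [eq_map_map (l := G.source x) fun _ => rfl, isEmptyElim x]
  · rintro (x | x)
    exacts [eq_map_map (l := G.target x) fun _ => rfl, isEmptyElim x]
  · exact eq_map_map (l := G.inputs) fun _ => rfl
  · exact map_eq_map (l := D.outputs) fun _ => rfl

/-- Composing on the left with a hypergraph without hyperedges, all of whose nodes are outputs,
only changes the inputs. -/
theorem comp_iso_withInputs {p q r : List S.Obj} (D : OpenHypergraph S p q)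
    (G : OpenHypergraph S q r) (he : IsEmpty D.Edge) (hD : ∀ n, n ∈ D.outputs)
    (φ : D.Node → G.Node) (hφ : D.outputs.map φ = G.inputs) :
    Iso (D.comp G) (G.withInputs (D.inputs.map φ)) := by
  have hz : ∀ n x, (n, x) ∈ D.outputs.zip G.inputs ↔ x = φ n := by
    intro n x
    rw [← hφ, mem_zip_map_right]
    simp [hD]
  refine ⟨⟨compDesc φ id fun n x h => ((hz n x).1 h).symm, compInr D G, ?_, fun _ => rfl⟩,
    Equiv.emptySum _ _, ?_, ?_, ?_, ?_, ?_, ?_⟩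
  · exact comp_cases (fun n => (compGlue ((hz n _).2 rfl)).symm) fun _ => rfl
  · exact comp_cases (fun n =>
      (label_eq_of_glue D G (Glue.mk _ _ ((hz n _).2 rfl))).symm) fun _ => rfl
  · rintro (x | x)
    exacts [isEmptyElim x, rfl]
  · rintro (x | x)
    exacts [isEmptyElim x, eq_map_map (l := G.source x) fun _ => rfl]
  · rintro (x | x)
    exacts [isEmptyElim x, eq_map_map (l := G.target x) fun _ => rfl]
  · exact map_eq_map (l := D.inputs) fun _ => rfl
  · exact eq_map_map (l := G.outputs) fun _ => rfl

theorem exists_map_eq {α β : Type*} {l : List α} {m : List β} (hl : l.Nodup) (h : ∀ a, a ∈ l)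
    (hlen : l.length = m.length) : ∃ φ : α → β, l.map φ = m := by
  classical
  refine ⟨fun a => m[l.idxOf a]'(hlen ▸ List.idxOf_lt_length_of_mem (h a)), ?_⟩
  refine List.ext_getElem (by simpa using hlen) fun i h1 h2 => ?_
  simp [hl.idxOf_getElem]

/-- An open hypergraph without hyperedges whose nodes are listed, without repetition, by the
inputs. -/
structure IsBij {p q : List S.Obj} (D : OpenHypergraph S p q) : Prop where
  edge : IsEmpty D.Edge
  nodup : D.inputs.Nodup
  mem : ∀ x, x ∈ D.inputs

/-- Moreover, the inputs are `a ++ b` and the outputs are `b ++ a`. -/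
structure IsSwap {p q : List S.Obj} (D : OpenHypergraph S p q) (a b : List D.Node) : Prop
    extends IsBij D where
  inputs_eq : D.inputs = a ++ b
  outputs_eq : D.outputs = b ++ a

theorem IsBij.tensor {p q p' q' : List S.Obj} {D : OpenHypergraph S p q}
    {E : OpenHypergraph S p' q'} (hD : D.IsBij) (hE : E.IsBij) : (D.tensor E).IsBij where
  edge := by
    have := hD.edge
    have := hE.edge
    exact inferInstanceAs (IsEmpty (D.Edge ⊕ E.Edge))
  nodup := by
    refine (hD.nodup.map Sum.inl_injective).append (hE.nodup.map Sum.inr_injective) ?_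
    intro x h1 h2
    obtain ⟨y, -, rfl⟩ := List.mem_map.1 h1
    obtain ⟨z, -, h⟩ := List.mem_map.1 h2
    cases h
  mem := by
    rintro (x | x)
    · exact List.mem_append_left _ (List.mem_map_of_mem (hD.mem x))
    · exact List.mem_append_right _ (List.mem_map_of_mem (hE.mem x))

theorem IsBij.exists_comp_iso {p q r : List S.Obj} {D : OpenHypergraph S q r} (hD : D.IsBij)
    (G : OpenHypergraph S p q) : ∃ φ : D.Node → G.Node, D.inputs.map φ = G.outputs ∧
      Iso (G.comp D) (G.withOutputs (D.outputs.map φ)) := by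
  obtain ⟨φ, hφ⟩ := exists_map_eq hD.nodup hD.mem
    ((length_inputs D).trans (length_outputs G).symm)
  exact ⟨φ, hφ, comp_iso_withOutputs G D hD.edge hD.mem φ hφ⟩

theorem IsSwap.mem_outputs {p q : List S.Obj} {D : OpenHypergraph S p q} {a b : List D.Node}
    (h : D.IsSwap a b) (x : D.Node) : x ∈ D.outputs := by
  have := h.mem x
  rw [h.inputs_eq, List.mem_append] at this
  rw [h.outputs_eq, List.mem_append]
  exact this.symm

theorem IsSwap.nodup_outputs {p q : List S.Obj} {D : OpenHypergraph S p q} {a b : List D.Node}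
    (h : D.IsSwap a b) : D.outputs.Nodup := by
  have := h.nodup
  rw [h.inputs_eq] at this
  rw [h.outputs_eq]
  exact List.nodup_append_comm.1 this

theorem IsSwap.of_iso {p q p' q' : List S.Obj} {D : OpenHypergraph S p q}
    {E : OpenHypergraph S p' q'} (h : Iso D E) {a b : List D.Node} (hD : D.IsSwap a b) :
    ∃ a' b' : List E.Node, E.IsSwap a' b' ∧ a'.length = a.length ∧ b'.length = b.length := by
  obtain ⟨φ, ψ, -, -, -, -, h5, h6⟩ := h
  refine ⟨a.map φ, b.map φ, ⟨⟨?_, ?_, fun x => ?_⟩, ?_, ?_⟩, by simp, by simp⟩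
  · have := hD.edge
    exact ψ.symm.isEmpty
  · rw [h5]
    exact hD.nodup.map φ.injective
  · rw [h5]
    exact List.mem_map.2 ⟨φ.symm x, hD.mem _, φ.apply_symm_apply x⟩
  · rw [h5, hD.inputs_eq, List.map_append]
  · rw [h6, hD.outputs_eq, List.map_append]

/-- Composition with an identity. -/
theorem IsSwap.comp_iso {p r : List S.Obj} {D : OpenHypergraph S p p} {a : List D.Node}
    (hD : D.IsSwap a []) (G : OpenHypergraph S p r) : Iso (D.comp G) G := by
  have hio : D.inputs = D.outputs := by rw [hD.inputs_eq, hD.outputs_eq]; simp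
  obtain ⟨φ, hφ⟩ := exists_map_eq hD.nodup_outputs hD.mem_outputs
    ((length_outputs D).trans (length_inputs G).symm)
  refine (comp_iso_withInputs D G hD.edge hD.mem_outputs φ hφ).trans
    ⟨Equiv.refl _, Equiv.refl _, fun _ => rfl, fun _ => rfl, fun _ => (List.map_id _).symm,
      fun _ => (List.map_id _).symm, ?_, (List.map_id _).symm⟩
  refine (Eq.trans ?_ (List.map_id _).symm)
  change G.inputs = D.inputs.map φ
  rw [hio, hφ]

theorem IsSwap.iso_comp {p r : List S.Obj} {D : OpenHypergraph S r r} {a : List D.Node}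
    (hD : D.IsSwap a []) (G : OpenHypergraph S p r) : Iso (G.comp D) G := by
  have hio : D.inputs = D.outputs := by rw [hD.inputs_eq, hD.outputs_eq]; simp
  obtain ⟨φ, hφ, hiso⟩ := hD.exists_comp_iso G
  refine hiso.trans
    ⟨Equiv.refl _, Equiv.refl _, fun _ => rfl, fun _ => rfl, fun _ => (List.map_id _).symm,
      fun _ => (List.map_id _).symm, (List.map_id _).symm, ?_⟩
  refine (Eq.trans ?_ (List.map_id _).symm)
  change G.outputs = D.outputs.map φ
  rw [← hio, hφ]

theorem IsSwap.nil {p : List S.Obj} {D : OpenHypergraph S p p} {a : List D.Node}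
    (hD : D.IsSwap a []) : D.IsSwap [] a :=
  ⟨hD.toIsBij, by simpa using hD.inputs_eq, by simpa using hD.outputs_eq⟩

theorem map_swap {α β : Type*} {φ : α → β} {a b : List α} {c d : List β}
    (h : (a ++ b).map φ = c ++ d) (hl : a.length = c.length) : (b ++ a).map φ = d ++ c := by
  rw [List.map_append] at h
  obtain ⟨h1, h2⟩ := List.append_inj h (by simpa using hl)
  rw [List.map_append, h1, h2]

theorem swap_lists {α β γ δ : Type*} {f : α → γ} {g : β → γ} {f' : α → δ} {g' : β → δ}
    {h : γ → δ} {l : List α} {m : List β} (h1 : ∀ x, f' x = h (f x)) (h2 : ∀ x, g' x = h (g x)) :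
    l.map f' ++ m.map g' = (l.map f ++ m.map g).map h := by
  rw [List.map_append, map_eq_map h1, map_eq_map h2]

/-- Naturality of the symmetries. -/
theorem symm_natural_iso {r p q : List S.Obj} (I : OpenHypergraph S r r)
    (G : OpenHypergraph S p q) {D : OpenHypergraph S (r ++ q) (q ++ r)} {a b : List D.Node}
    (hD : D.IsSwap a b) (ha : a.length = r.length)
    {E : OpenHypergraph S (r ++ p) (p ++ r)} {a' b' : List E.Node} (hE : E.IsSwap a' b')
    (hb' : b'.length = p.length) :
    Iso ((I.tensor G).comp D) (E.comp (G.tensor I)) := by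
  obtain ⟨φ, hφ, h1⟩ : ∃ φ : D.Node → I.Node ⊕ G.Node,
      D.inputs.map φ = I.outputs.map Sum.inl ++ G.outputs.map Sum.inr ∧
      Iso ((I.tensor G).comp D) ((I.tensor G).withOutputs (D.outputs.map φ)) :=
    hD.exists_comp_iso (I.tensor G)
  obtain ⟨χ, hχ⟩ : ∃ χ : E.Node → G.Node ⊕ I.Node,
      E.outputs.map χ = G.inputs.map Sum.inl ++ I.inputs.map Sum.inr :=
    exists_map_eq hE.nodup_outputs hE.mem_outputs
      ((length_outputs E).trans (length_inputs (G.tensor I)).symm)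
  have h2 := comp_iso_withInputs E (G.tensor I) hE.edge hE.mem_outputs χ hχ
  refine h1.trans (Iso.trans ?_ h2.symm)
  rw [hD.inputs_eq] at hφ
  rw [hE.outputs_eq] at hχ
  have e1 := map_swap hφ (by simp [length_outputs, ha])
  have e2 := map_swap hχ (by simp [length_inputs, hb'])
  rw [← hD.outputs_eq] at e1
  rw [← hE.inputs_eq] at e2
  refine ⟨Equiv.sumComm _ _, Equiv.sumComm _ _, ?_, ?_, ?_, ?_, ?_, ?_⟩
  · rintro (x | x) <;> rfl
  · rintro (x | x) <;> rfl
  · rintro (x | x)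
    · exact map_eq_map (l := I.source x) fun _ => rfl
    · exact map_eq_map (l := G.source x) fun _ => rfl
  · rintro (x | x)
    · exact map_eq_map (l := I.target x) fun _ => rfl
    · exact map_eq_map (l := G.target x) fun _ => rfl
  · exact e2.trans (swap_lists (l := I.inputs) (m := G.inputs) (fun _ => rfl) fun _ => rfl)
  · have e3 : G.outputs.map Sum.inl ++ I.outputs.map Sum.inr =
        (D.outputs.map φ).map (Equiv.sumComm I.Node G.Node) := by
      rw [e1]
      exact swap_lists (fun _ => rfl) fun _ => rfl
    exact e3

/-- The symmetries are inverse to each other. -/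
theorem symm_symm_iso {p q : List S.Obj} {D : OpenHypergraph S (p ++ q) (q ++ p)}
    {a b : List D.Node} (hD : D.IsSwap a b) (hb : b.length = q.length)
    {E : OpenHypergraph S (q ++ p) (p ++ q)} {a' b' : List E.Node} (hE : E.IsSwap a' b')
    (ha' : a'.length = q.length) {I : OpenHypergraph S (p ++ q) (p ++ q)} {c : List I.Node}
    (hI : I.IsSwap c []) :
    Iso (D.comp E) I := by
  obtain ⟨φ, hφ, h1⟩ := hE.exists_comp_iso D
  rw [hE.inputs_eq, hD.outputs_eq] at hφ
  have e1 := map_swap hφ (by simp [ha', hb])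
  rw [← hE.outputs_eq] at e1
  have h2 : (D.withOutputs (E.outputs.map φ)).IsSwap (id (a ++ b) : List D.Node) [] :=
    ⟨⟨hD.edge, hD.nodup, hD.mem⟩, hD.inputs_eq.trans (List.append_nil _).symm, e1⟩
  obtain ⟨l, m, h3, -, hm⟩ := h2.of_iso h1.symm
  obtain rfl : m = [] := List.length_eq_zero_iff.1 hm
  exact (hI.iso_comp _).symm.trans (h3.comp_iso I)

theorem word_lists {α β γ δ : Type*} {φ : α ⊕ β → γ ⊕ δ} {c d : List α} {l : List β}
    {a b : List δ} {x : γ}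
    (h : ((c ++ d).map Sum.inl ++ l.map Sum.inr).map φ = Sum.inl x :: (b ++ a).map Sum.inr)
    (hc : c.length = 1) (hd : d.length = b.length) :
    ((d ++ c).map Sum.inl ++ l.map Sum.inr).map φ =
      b.map Sum.inr ++ Sum.inl x :: a.map Sum.inr := by
  rw [List.map_append, List.map_append (f := Sum.inr), ← List.cons_append] at h
  obtain ⟨h1, h2⟩ := List.append_inj h (by simp [hc, hd, add_comm])
  rw [List.map_append] at h1
  have h3 := map_swap (c := [Sum.inl x]) h1 (by simp [hc])
  rw [List.map_append, h2, List.map_append, h3]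
  simp

/-- Isomorphism of open hypergraphs of a fixed type, as a setoid. -/
def setoid (S : Signature.{u, v}) (p q : List S.Obj) : Setoid (OpenHypergraph S p q) where
  r := Iso
  iseqv := ⟨Iso.refl, Iso.symm, Iso.trans⟩

end OpenHypergraph

/-- Open hypergraphs up to isomorphism, i.e. the morphisms `p → q` of the category of cospans. -/
def OpenHypergraphClass (S : Signature.{u, v}) (p q : List S.Obj) : Type (max 1 u v) :=
  Quotient (OpenHypergraph.setoid S p q)

/-- The isomorphism class of an open hypergraph. -/
def OpenHypergraph.toClass {S : Signature.{u, v}} {p q : List S.Obj} (G : OpenHypergraph S p q) :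
    OpenHypergraphClass S p q :=
  Quotient.mk (OpenHypergraph.setoid S p q) G

/-- The interpretation of terms as open hypergraphs, by induction on terms. -/
def SigTerm.interp {S : Signature.{u, v}} :
    {p q : List S.Obj} → SigTerm S p q → OpenHypergraph S p q
  | _, _, .op d => .ofOp d
  | _, _, .id x => .ofId x
  | _, _, .symm x y => .ofSymm x y
  | _, _, .null => .ofNull
  | _, _, .comp c d => .comp c.interp d.interp
  | _, _, .tensor c d => .tensor c.interp d.interp

namespace SigTerm

variable {S : Signature.{u, v}}

theorem interp_cast_iso {p q p' q' : List S.Obj} (hp : p = p') (hq : q = q')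
    (c : SigTerm S p q) : c.interp.Iso (cast hp hq c).interp := by
  subst hp hq
  exact .refl _

theorem idWord_isSwap (p : List S.Obj) : ∃ a, (idWord p).interp.IsSwap a [] := by
  induction p with
  | nil => exact ⟨[], ⟨⟨⟨Empty.elim⟩, List.nodup_nil, fun x => x.elim⟩, rfl, rfl⟩⟩
  | cons x p ih =>
    obtain ⟨a, ha⟩ := ih
    have h1 : (id x).interp.IsBij :=
      ⟨⟨Empty.elim⟩, List.nodup_singleton _, fun _ => List.mem_singleton.2 rfl⟩
    refine ⟨Sum.inl () :: a.map Sum.inr, ⟨h1.tensor ha.toIsBij, ?_, ?_⟩⟩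
    · have h := ha.inputs_eq
      rw [List.append_nil] at h
      refine Eq.trans ?_ (List.append_nil _).symm
      exact congrArg (fun l => Sum.inl () :: l.map Sum.inr) h
    · exact congrArg (fun l => Sum.inl () :: l.map Sum.inr) ha.outputs_eq

theorem symmOne_isSwap (x : S.Obj) (q : List S.Obj) :
    ∃ a b, (symmOne x q).interp.IsSwap a b ∧ a.length = 1 ∧ b.length = q.length := by
  have hid (x : S.Obj) : (id x).interp.IsBij :=
    ⟨⟨Empty.elim⟩, List.nodup_singleton _, fun _ => List.mem_singleton.2 rfl⟩
  induction q with
  | nil => exact ⟨[()], [], ⟨hid x, rfl, rfl⟩, rfl, rfl⟩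
  | cons y q ih =>
    obtain ⟨a, b, hab, ha, hb⟩ := ih
    obtain ⟨l, hl⟩ := idWord_isSwap q
    have hsymm : (symm x y).interp.IsBij :=
      ⟨⟨Empty.elim⟩, show [false, true].Nodup by decide,
        show ∀ n : Bool, n ∈ [false, true] by decide⟩
    have hP := hsymm.tensor hl.toIsBij
    have hD := (hid y).tensor hab.toIsBij
    obtain ⟨φ, hφ, hiso⟩ : ∃ φ : Unit ⊕ (symmOne x q).interp.Node → Bool ⊕ (idWord q).interp.Node,
        (.inl () :: (symmOne x q).interp.inputs.map .inr).map φ =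
          .inl true :: .inl false :: (idWord q).interp.outputs.map .inr ∧
        OpenHypergraph.Iso (((symm x y).interp.tensor (idWord q).interp).comp
            ((id y).interp.tensor (symmOne x q).interp))
          (((symm x y).interp.tensor (idWord q).interp).withOutputs
            (((id y).interp.tensor (symmOne x q).interp).outputs.map φ)) :=
      hD.exists_comp_iso ((symm x y).interp.tensor (idWord q).interp)
    have hlin := hl.inputs_eq
    have hlout := hl.outputs_eq
    rw [List.append_nil] at hlin
    rw [List.nil_append] at hlout
    have hlen : l.length = q.length := by
      rw [← hlin, OpenHypergraph.length_inputs]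
    rw [hab.inputs_eq, hlout, List.map_cons, List.cons.injEq, List.map_append] at hφ
    have e1 := OpenHypergraph.map_swap (c := [Sum.inl false]) hφ.2 (by simp [ha])
    rw [← List.map_append, ← hab.outputs_eq] at e1
    have hs : (((symm x y).interp.tensor (idWord q).interp).withOutputs
            (((id y).interp.tensor (symmOne x q).interp).outputs.map φ)).IsSwap
          ([.inl false] : List (Bool ⊕ (idWord q).interp.Node))
          (.inl true :: l.map .inr : List (Bool ⊕ (idWord q).interp.Node)) :=
      ⟨⟨hP.edge, hP.nodup, hP.mem⟩, congrArg (fun l : List (idWord q).interp.Node =>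
        Sum.inl false :: Sum.inl true :: l.map Sum.inr) hlin,
        congrArg₂ List.cons hφ.1 e1⟩
    obtain ⟨a', b', h, h1, h2⟩ := hs.of_iso hiso.symm
    exact ⟨a', b', h, h1, h2.trans (congrArg (· + 1) ((List.length_map _).trans hlen))⟩

theorem symmWord_isSwap (p q : List S.Obj) :
    ∃ a b, (symmWord p q).interp.IsSwap a b ∧ a.length = p.length ∧ b.length = q.length := by
  have hid (x : S.Obj) : (id x).interp.IsBij :=
    ⟨⟨Empty.elim⟩, List.nodup_singleton _, fun _ => List.mem_singleton.2 rfl⟩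
  induction p with
  | nil =>
    obtain ⟨l, hl⟩ := idWord_isSwap q
    obtain ⟨a, b, h, h1, h2⟩ := hl.nil.of_iso
      (interp_cast_iso rfl (List.append_nil q).symm (idWord q))
    refine ⟨a, b, h, h1, h2.trans ?_⟩
    rw [← OpenHypergraph.length_inputs (idWord q).interp, hl.inputs_eq, List.append_nil]
  | cons x p ih =>
    obtain ⟨a, b, hab, ha, hb⟩ := ih
    obtain ⟨c, d, hcd, hc, hd⟩ := symmOne_isSwap x q
    obtain ⟨l, hl⟩ := idWord_isSwap p
    have hP := (hid x).tensor hab.toIsBij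
    have hD := hcd.toIsBij.tensor hl.toIsBij
    obtain ⟨φ, hφ, hiso⟩ : ∃ φ : (symmOne x q).interp.Node ⊕ (idWord p).interp.Node →
          Unit ⊕ (symmWord p q).interp.Node,
        List.map φ
            ((symmOne x q).interp.inputs.map Sum.inl ++ (idWord p).interp.inputs.map Sum.inr) =
          Sum.inl () :: (symmWord p q).interp.outputs.map Sum.inr ∧
        OpenHypergraph.Iso (((id x).interp.tensor (symmWord p q).interp).comp
            ((symmOne x q).interp.tensor (idWord p).interp))
          (((id x).interp.tensor (symmWord p q).interp).withOutputs
            (((symmOne x q).interp.tensor (idWord p).interp).outputs.map φ)) :=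
      hD.exists_comp_iso ((id x).interp.tensor (symmWord p q).interp)
    have hlin := hl.inputs_eq
    have hlout := hl.outputs_eq
    rw [List.append_nil] at hlin
    rw [List.nil_append] at hlout
    rw [hcd.inputs_eq, hlin, hab.outputs_eq] at hφ
    have e1 := OpenHypergraph.word_lists hφ hc (hd.trans hb.symm)
    rw [← hcd.outputs_eq, ← hlout] at e1
    have hs : (((id x).interp.tensor (symmWord p q).interp).withOutputs
            (((symmOne x q).interp.tensor (idWord p).interp).outputs.map φ)).IsSwap
          (.inl () :: a.map .inr : List (Unit ⊕ (symmWord p q).interp.Node))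
          (b.map .inr : List (Unit ⊕ (symmWord p q).interp.Node)) :=
      ⟨⟨hP.edge, hP.nodup, hP.mem⟩,
        congrArg (List.cons (Sum.inl ()))
          ((congrArg (List.map Sum.inr) hab.inputs_eq).trans List.map_append), e1⟩
    obtain ⟨a', b', h, h1, h2⟩ := hs.of_iso (hiso.symm.trans
      ((OpenHypergraph.Iso.refl _).comp (interp_cast_iso (List.append_assoc [x] q p)
        (List.append_assoc q [x] p) (tensor (symmOne x q) (idWord p)))))
    exact ⟨a', b', h, h1.trans (congrArg (· + 1) ((List.length_map _).trans ha)),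
      h2.trans ((List.length_map _).trans hb)⟩

/-- Terms that are equal modulo the laws of symmetric monoidal categories have isomorphic
interpretations. -/
theorem Equiv.interp_iso {p q : List S.Obj} {c d : SigTerm S p q} (h : Equiv c d) :
    c.interp.Iso d.interp := by
  induction h with
  | refl c => exact .refl _
  | symm _ ih => exact ih.symm
  | trans _ _ ih ih' => exact ih.trans ih'
  | comp_congr _ _ ih ih' => exact ih.comp ih'
  | tensor_congr _ _ ih ih' => exact ih.tensor ih'
  | comp_assoc c d e => exact OpenHypergraph.comp_assoc_iso _ _ _
  | id_comp c =>
    obtain ⟨a, ha⟩ := idWord_isSwap _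
    exact ha.comp_iso _
  | comp_id c =>
    obtain ⟨a, ha⟩ := idWord_isSwap _
    exact ha.iso_comp _
  | interchange c₁ d₁ c₂ d₂ => exact OpenHypergraph.interchange_iso _ _ _ _
  | tensor_assoc c₁ c₂ c₃ =>
    exact (interp_cast_iso _ _ _).symm.trans (OpenHypergraph.tensor_assoc_iso _ _ _)
  | null_tensor c => exact OpenHypergraph.null_tensor_iso _
  | tensor_null c =>
    exact (interp_cast_iso _ _ _).symm.trans (OpenHypergraph.tensor_null_iso _)
  | symm_natural r c =>
    obtain ⟨a, b, h, ha, -⟩ := symmWord_isSwap r _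
    obtain ⟨a', b', h', -, hb'⟩ := symmWord_isSwap r _
    exact OpenHypergraph.symm_natural_iso _ _ h ha h' hb'
  | symm_symm p q =>
    obtain ⟨a, b, h, -, hb⟩ := symmWord_isSwap p q
    obtain ⟨a', b', h', ha', -⟩ := symmWord_isSwap q p
    obtain ⟨c, hc⟩ := idWord_isSwap (p ++ q)
    exact OpenHypergraph.symm_symm_iso h hb h' ha' hc

end SigTerm

/-- The interpretation of string diagrams as open hypergraphs (up to isomorphism), induced by the
interpretation of terms. -/
def StringDiagram.interp {S : Signature.{u, v}} {p q : List S.Obj} :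
    StringDiagram S p q → OpenHypergraphClass S p q :=
  Quotient.lift (fun c : SigTerm S p q => c.interp.toClass) fun _ _ h =>
    Quotient.sound (s := OpenHypergraph.setoid S p q) (SigTerm.Equiv.interp_iso h)

end StringDiag

/-! Monogamy is a statement about lists: the inputs followed by the targets of all hyperedges meet
every node exactly once, and so do the outputs followed by all sources
(`enumerates_append_flatMap_iff`). Acyclicity of a finite hypergraph means that its hyperedges carry
a natural number that increases along paths. A `Schedule` bundles both, and `exists_schedule_iff`
shows that it is equivalent to the right-hand side of the theorem.

Every term has a schedule, by induction. The delicate case is the pushout (`Schedule.comp`): both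
glued interfaces are free of duplicates, so a node of the composite comes from one node, or from one
output of the first factor glued to one input of the second. Hence no node is listed twice, and
hyperedges of the second factor can be ranked above all those of the first.

Conversely, a term is built by induction on the number of hyperedges (`Schedule.isTermLike`).
Without hyperedges, inputs and outputs list the same nodes and differ by a permutation, which is a
composite of symmetries (`exists_isWiring_of_perm`). Otherwise let `e` be a hyperedge of minimal
rank. Its sources are inputs, because a node that is not an input is the target of a hyperedge, and
that one would have smaller rank than `e`. Permuting the inputs brings the sources of `e` to the
front; then the hypergraph is the layer `e ⊗ id` followed by a remainder (`IsTermLike.of_restrict`),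
which has a schedule with one hyperedge fewer. -/

namespace StringDiag

universe u v

/-! ### Lists that enumerate a type. -/

/-- The list `l` contains every element of `α` exactly once. -/
structure Enumerates {α : Type*} (l : List α) : Prop where
  nodup : l.Nodup
  mem : ∀ x, x ∈ l

namespace Enumerates

variable {α β : Type*}

theorem perm {l l' : List α} (h : Enumerates l) (hl : l.Perm l') : Enumerates l' :=
  ⟨hl.nodup_iff.1 h.nodup, fun x => hl.mem_iff.1 (h.mem x)⟩

theorem map {l : List α} (h : Enumerates l) (φ : α ≃ β) : Enumerates (l.map φ) :=
  ⟨h.nodup.map φ.injective, fun x => List.mem_map.2 ⟨φ.symm x, h.mem _, φ.apply_symm_apply x⟩⟩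

theorem sum {l : List α} {m : List β} (hl : Enumerates l) (hm : Enumerates m) :
    Enumerates (l.map Sum.inl ++ m.map Sum.inr) where
  nodup := by
    refine (hl.nodup.map Sum.inl_injective).append (hm.nodup.map Sum.inr_injective) ?_
    intro x h1 h2
    obtain ⟨y, -, rfl⟩ := List.mem_map.1 h1
    obtain ⟨z, -, h⟩ := List.mem_map.1 h2
    cases h
  mem := by
    rintro (x | x)
    · exact List.mem_append_left _ (List.mem_map_of_mem (hl.mem x))
    · exact List.mem_append_right _ (List.mem_map_of_mem (hm.mem x))

/-- A schedule lists the interface before the nodes attached to hyperedges. For a disjoint union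
both interfaces must come first, so the two middle blocks are exchanged. -/
theorem sum_append {a b : List α} {c d : List β}
    (h : Enumerates (a ++ b)) (h' : Enumerates (c ++ d)) :
    Enumerates ((a.map Sum.inl ++ c.map Sum.inr) ++ (b.map Sum.inl ++ d.map Sum.inr)) := by
  refine (h.sum h').perm ?_
  simp only [List.map_append, List.append_assoc]
  refine List.Perm.append_left _ ?_
  simp only [← List.append_assoc]
  exact List.Perm.append_right _ List.perm_append_comm

theorem finRange (n : ℕ) : Enumerates (List.finRange n) :=
  ⟨List.nodup_finRange n, List.mem_finRange⟩

theorem iff_count [DecidableEq α] {l : List α} : Enumerates l ↔ ∀ x, l.count x = 1 := by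
  constructor
  · exact fun h x => List.count_eq_one_of_mem h.nodup (h.mem x)
  · exact fun h => ⟨List.nodup_iff_count_le_one.2 fun x => (h x).le,
      fun x => List.count_pos_iff.1 (by simp [h x])⟩

theorem exists_of_finite (α : Type*) [Finite α] : ∃ l : List α, Enumerates l := by
  have := Fintype.ofFinite α
  exact ⟨Finset.univ.toList, Finset.nodup_toList _, fun x => by simp⟩

theorem injective_of_nodup_map {l : List α} (hl : ∀ x, x ∈ l) {f : α → β}
    (h : (l.map f).Nodup) : Function.Injective f :=
  fun x y => List.inj_on_of_nodup_map h (hl x) (hl y)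

theorem of_map_val {P : α → Prop} {l : List {x // P x}} (h : (l.map Subtype.val).Nodup)
    (h' : ∀ x, P x → x ∈ l.map Subtype.val) : Enumerates l where
  nodup := h.of_map
  mem x := by
    obtain ⟨y, hy, hyx⟩ := List.mem_map.1 (h' x x.2)
    rwa [← Subtype.ext hyx]

end Enumerates

/-! ### Degrees as multiplicities in lists. -/

theorem ncard_getElem?_eq_count {α : Type*} [DecidableEq α] (l : List α) (x : α) :
    {i : ℕ | l[i]? = some x}.Finite ∧ {i : ℕ | l[i]? = some x}.ncard = l.count x := by
  induction l with
  | nil => simp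
  | cons a l ih =>
    obtain ⟨hf, hc⟩ := ih
    by_cases hax : a = x
    · have : {i : ℕ | (a :: l)[i]? = some x} =
          insert 0 (Nat.succ '' {i : ℕ | l[i]? = some x}) := by
        ext i
        cases i <;> simp [hax]
      rw [this]
      refine ⟨(hf.image _).insert _, ?_⟩
      rw [Set.ncard_insert_of_notMem (by simp) (hf.image _),
        Set.ncard_image_of_injective _ Nat.succ_injective, hc]
      simp [hax]
    · have : {i : ℕ | (a :: l)[i]? = some x} = Nat.succ '' {i : ℕ | l[i]? = some x} := by
        ext i
        cases i <;> simp [hax]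
      rw [this]
      refine ⟨hf.image _, ?_⟩
      rw [Set.ncard_image_of_injective _ Nat.succ_injective, hc, List.count_cons_of_ne hax]

/-- The pairs are sorted by their hyperedge, and each hyperedge contributes the multiplicity of `x`
in its own list. Finiteness travels through the induction because `Set.ncard` is additive only on
finite sets. -/
theorem ncard_getElem?_eq_count_flatMap {α ι : Type*} [DecidableEq α] (t : ι → List α) (x : α)
    {es : List ι} (hes : es.Nodup) :
    {a : ι × ℕ | a.1 ∈ es ∧ (t a.1)[a.2]? = some x}.Finite ∧
    {a : ι × ℕ | a.1 ∈ es ∧ (t a.1)[a.2]? = some x}.ncard = (es.flatMap t).count x := by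
  induction es with
  | nil => simp
  | cons e es ih =>
    obtain ⟨hf, hc⟩ := ih hes.of_cons
    obtain ⟨hf', hc'⟩ := ncard_getElem?_eq_count (t e) x
    have : {a : ι × ℕ | a.1 ∈ e :: es ∧ (t a.1)[a.2]? = some x} =
        (Prod.mk e '' {i : ℕ | (t e)[i]? = some x}) ∪
          {a : ι × ℕ | a.1 ∈ es ∧ (t a.1)[a.2]? = some x} := by
      ext ⟨f, i⟩
      simp only [List.mem_cons, Set.mem_ofPred_eq, Set.mem_union, Set.mem_image, Prod.mk.injEq]
      constructor
      · rintro ⟨rfl | h, h'⟩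
        exacts [.inl ⟨i, h', rfl, rfl⟩, .inr ⟨h, h'⟩]
      · rintro (⟨j, h, rfl, rfl⟩ | h)
        exacts [⟨.inl rfl, h⟩, ⟨.inr h.1, h.2⟩]
    rw [this]
    refine ⟨(hf'.image _).union hf, ?_⟩
    rw [Set.ncard_union_eq _ (hf'.image _) hf, Set.ncard_image_of_injective _
      (Prod.mk_right_injective e), hc, hc', List.flatMap_cons, List.count_append]
    rw [Set.disjoint_left]
    rintro _ ⟨i, -, rfl⟩ h
    exact (List.nodup_cons.1 hes).1 h.1

/-- The multiplicity of `x` in the whole list is its multiplicity in `l` plus its degree. This sum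
is `1` for all `x` exactly when `l` has no duplicates and the degree is `0` on `l` and `1`
elsewhere. Taking inputs and targets gives the in-degree half of monogamy, outputs and sources the
other half. -/
theorem enumerates_append_flatMap_iff {α ι : Type*} {t : ι → List α} {l : List α} {es : List ι}
    (hes : Enumerates es) :
    Enumerates (l ++ es.flatMap t) ↔ Function.Injective l.get ∧
      (∀ x ∈ Set.range l.get, {a : ι × ℕ | (t a.1)[a.2]? = some x}.ncard = 0) ∧
      (∀ x ∉ Set.range l.get, {a : ι × ℕ | (t a.1)[a.2]? = some x}.ncard = 1) := by
  classical
  have hc (x) : {a : ι × ℕ | (t a.1)[a.2]? = some x}.ncard = (es.flatMap t).count x := by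
    rw [← (ncard_getElem?_eq_count_flatMap t x hes.nodup).2]
    simp [hes.mem]
  have hr (x) : x ∈ Set.range l.get ↔ x ∈ l := by
    simp [List.mem_iff_get]
  simp only [hc, hr, Enumerates.iff_count, List.count_append, List.nodup_iff_injective_get.symm,
    List.nodup_iff_count_le_one]
  constructor
  · intro h
    refine ⟨fun x => by have := h x; omega, fun x hx => ?_, fun x hx => ?_⟩
    · have := h x
      have := List.count_pos_iff.2 hx
      omega
    · have := h x
      rwa [List.count_eq_zero.2 hx, zero_add] at this
  · rintro ⟨h1, h2, h3⟩ x
    by_cases hx : x ∈ l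
    · have := h1 x
      have := List.count_pos_iff.2 hx
      have := h2 x hx
      omega
    · rw [List.count_eq_zero.2 hx, h3 x hx]

/-! ### Ranks on hyperedges and acyclicity. -/

namespace Hypergraph

variable {S : Signature.{u, v}}

/-- A function on the hyperedges that strictly increases along directed paths. -/
def IsRank (G : Hypergraph S) (key : G.Edge → ℕ) : Prop :=
  ∀ e f x, x ∈ G.target e → x ∈ G.source f → key e < key f

/-- The rank of the first hyperedge of a path is at most that of the last. On a closed path the last
one feeds the first, which forces the strict opposite inequality. -/
theorem IsRank.acyclic {G : Hypergraph S} {key : G.Edge → ℕ} (h : G.IsRank key) :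
    G.Acyclic := by
  have aux {x y : G.Node} (hxy : Relation.TransGen G.Step x y) :
      ∃ e f, x ∈ G.source e ∧ y ∈ G.target f ∧ key e ≤ key f := by
    induction hxy with
    | single hs =>
      obtain ⟨e, h1, h2⟩ := hs
      exact ⟨e, e, h1, h2, le_rfl⟩
    | tail _ hs ih =>
      obtain ⟨e, f, h1, h2, h3⟩ := ih
      obtain ⟨g, h4, h5⟩ := hs
      exact ⟨e, g, h1, h5, h3.trans (h f g _ h2 h4).le⟩
  intro x hx
  obtain ⟨e, f, h1, h2, h3⟩ := aux hx
  exact (h f e x h2 h1).not_ge h3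

/-- Nodes are ranked by the number of nodes that reach them along nonempty paths; a hyperedge is
then ranked by its highest source. -/
theorem Acyclic.exists_isRank {G : Hypergraph S} (h : G.Acyclic) : ∃ key, G.IsRank key := by
  classical
  have := G.finite_node
  let r (x : G.Node) : ℕ := {y | Relation.TransGen G.Step y x}.ncard
  have hr {x y : G.Node} (hxy : G.Step x y) : r x < r y := by
    -- The inclusion is strict because `x` precedes `y` but, by acyclicity, does not precede itself.
    refine Set.ncard_lt_ncard ⟨fun z hz => hz.tail hxy, fun hs => ?_⟩ (Set.toFinite _)
    exact h x (hs (.single hxy))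
  -- If `x` is a target of `e` and a source of `f`, then `key e ≤ r x < r x + 1 ≤ key f`. The `+ 1`
  -- makes this strict even when `e` has no sources and hence `key e = 0`.
  refine ⟨fun e => (G.source e).toFinset.sup fun x => r x + 1, fun e f x he hf => ?_⟩
  refine lt_of_le_of_lt (Finset.sup_le (a := r x) fun y hy => hr ⟨e, by simpa using hy, he⟩) ?_
  exact Nat.lt_of_succ_le
    (Finset.le_sup (f := fun x => r x + 1) (List.mem_toFinset.2 hf))

end Hypergraph

/-! ### Schedules, and their construction for generators and parallel composites. -/

namespace OpenHypergraph

variable {S : Signature.{u, v}} {p q r p' q' p₁ p₂ q₁ q₂ : List S.Obj}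

/-- `es` lists the hyperedges, `key` increases along paths, and every node is exactly once an input
or a target, and exactly once an output or a source. -/
structure Schedule (G : OpenHypergraph S p q) (es : List G.Edge) (key : G.Edge → ℕ) : Prop where
  edges : Enumerates es
  targets : Enumerates (G.inputs ++ es.flatMap G.target)
  sources : Enumerates (G.outputs ++ es.flatMap G.source)
  rank : G.IsRank key

theorem exists_schedule_iff {G : OpenHypergraph S p q} :
    (∃ es key, G.Schedule es key) ↔ G.Monogamous ∧ G.Acyclic := by
  constructor
  · rintro ⟨es, key, h⟩
    obtain ⟨h1, h2, h3⟩ := (enumerates_append_flatMap_iff h.edges).1 h.targets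
    obtain ⟨h4, h5, h6⟩ := (enumerates_append_flatMap_iff h.edges).1 h.sources
    exact ⟨⟨h1, h4, h2, h3, h5, h6⟩, h.rank.acyclic⟩
  · rintro ⟨h, h'⟩
    have := G.finite_edge
    obtain ⟨es, hes⟩ := Enumerates.exists_of_finite G.Edge
    obtain ⟨key, hkey⟩ := h'.exists_isRank
    exact ⟨es, key, hes,
      (enumerates_append_flatMap_iff hes).2
        ⟨h.inputs_injective, h.inDegree_of_mem, h.inDegree_of_not_mem⟩,
      (enumerates_append_flatMap_iff hes).2
        ⟨h.outputs_injective, h.outDegree_of_mem, h.outDegree_of_not_mem⟩, hkey⟩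

theorem Schedule.of_iso {G : OpenHypergraph S p q} {H : OpenHypergraph S p' q'} (h : Iso G H)
    {es : List G.Edge} {key : G.Edge → ℕ} (hG : G.Schedule es key) :
    ∃ es key, H.Schedule es key := by
  obtain ⟨φ, ψ, -, -, h3, h4, h5, h6⟩ := h
  refine ⟨es.map ψ, key ∘ ψ.symm, hG.edges.map ψ, ?_, ?_, fun e f x he hf => ?_⟩
  · have := hG.targets.map φ
    simpa [h5, List.flatMap_map, List.map_flatMap, h4] using this
  · have := hG.sources.map φ
    simpa [h6, List.flatMap_map, List.map_flatMap, h3] using this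
  · obtain ⟨e, rfl⟩ := ψ.surjective e
    obtain ⟨f, rfl⟩ := ψ.surjective f
    obtain ⟨x, rfl⟩ := φ.surjective x
    rw [h4, List.mem_map_of_injective φ.injective] at he
    rw [h3, List.mem_map_of_injective φ.injective] at hf
    simpa using hG.rank e f x he hf

/-- The source and target maps of both `tensor` and `comp` have this shape by definition, with the
inclusions of the nodes as `f` and `g`. -/
theorem flatMap_sumElim {α β γ δ ε : Type*} {t : α → List γ} {t' : β → List δ} {f : γ → ε}
    {g : δ → ε} {l : List α} {m : List β} :
    (l.map Sum.inl ++ m.map Sum.inr).flatMap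
        (Sum.elim (fun e => (t e).map f) fun e => (t' e).map g) =
      (l.flatMap t).map f ++ (m.flatMap t').map g := by
  simp [List.flatMap_map, List.map_flatMap]

theorem schedule_of_isEmpty {G : OpenHypergraph S p q} (he : IsEmpty G.Edge)
    (hi : Enumerates G.inputs) (ho : Enumerates G.outputs) : G.Schedule [] fun _ => 0 where
  edges := ⟨List.nodup_nil, fun e => he.elim e⟩
  targets := by simpa using hi
  sources := by simpa using ho
  rank e := he.elim e

theorem schedule_ofOp (d : S.Op) : (ofOp d).Schedule [()] fun _ => 0 where
  edges := ⟨List.nodup_singleton _, fun _ => List.mem_singleton.2 rfl⟩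
  targets := by
    have h := (Enumerates.finRange (S.arity d).length).sum (.finRange (S.coarity d).length)
    -- The `flatMap` over the single hyperedge unfolds to a list followed by `[]`.
    rw [← List.append_nil (List.map Sum.inr _)] at h
    exact h
  sources := by
    have h := ((Enumerates.finRange (S.arity d).length).sum
      (.finRange (S.coarity d).length)).perm List.perm_append_comm
    rw [← List.append_nil (List.map Sum.inl _)] at h
    exact h
  rank e f x he hf := by
    obtain ⟨y, -, rfl⟩ := List.mem_map.1 he
    obtain ⟨z, -, h⟩ := List.mem_map.1 hf
    cases h

theorem Schedule.tensor {G : OpenHypergraph S p₁ q₁} {H : OpenHypergraph S p₂ q₂}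
    {es : List G.Edge} {key : G.Edge → ℕ} {es' : List H.Edge} {key' : H.Edge → ℕ}
    (hG : G.Schedule es key) (hH : H.Schedule es' key') :
    (G.tensor H).Schedule (es.map Sum.inl ++ es'.map Sum.inr) (Sum.elim key key') where
  edges := hG.edges.sum hH.edges
  targets := (hG.targets.sum_append hH.targets).perm
    (List.Perm.of_eq (congrArg _ flatMap_sumElim.symm))
  sources := (hG.sources.sum_append hH.sources).perm
    (List.Perm.of_eq (congrArg _ flatMap_sumElim.symm))
  rank := by
    rintro (e | e) (f | f) x he hf <;> obtain ⟨y, hy, rfl⟩ := List.mem_map.1 he <;>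
      obtain ⟨z, hz, h⟩ := List.mem_map.1 hf <;> cases h
    exacts [hG.rank e f _ hy hz, hH.rank e f _ hy hz]

/-! ### Gluing along duplicate-free interfaces, and schedules of sequential composites. -/

theorem zip_inj_of_nodup {α β : Type*} {l : List α} {m : List β} (hl : l.Nodup) (hm : m.Nodup)
    {x x' : α} {y y' : β} (h : (x, y) ∈ l.zip m) (h' : (x', y') ∈ l.zip m) : x = x' ↔ y = y' := by
  obtain ⟨i, hi, h⟩ := List.mem_iff_getElem.1 h
  obtain ⟨j, hj, h'⟩ := List.mem_iff_getElem.1 h'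
  simp only [List.getElem_zip, Prod.mk.injEq] at h h'
  rw [← h.1, ← h.2, ← h'.1, ← h'.2, hl.getElem_inj_iff, hm.getElem_inj_iff]

/-- Without duplicates in the interfaces, `Glue` is a partial bijection from nodes of `G` to nodes
of `H`. Its reflexive and symmetric closure is therefore already transitive. -/
theorem eq_or_glue_of_quot_eq {G : OpenHypergraph S p q} {H : OpenHypergraph S q r}
    (hG : G.outputs.Nodup) (hH : H.inputs.Nodup) {a b : G.Node ⊕ H.Node}
    (h : Quot.mk (Glue G H) a = Quot.mk (Glue G H) b) : a = b ∨ Glue G H a b ∨ Glue G H b a := by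
  replace h := Quot.eqvGen_exact h
  induction h with
  | rel a b h => exact .inr (.inl h)
  | refl a => exact .inl rfl
  | symm a b hab ih =>
    rcases ih with rfl | h | h
    exacts [.inl rfl, .inr (.inr h), .inr (.inl h)]
  | trans a b c hab hbc ih ih' =>
    rcases ih with rfl | h | h
    · exact ih'
    -- Two consecutive gluings in the same direction are impossible, as the middle node would lie in
    -- both summands; two in opposite directions lead back to the starting node.
    all_goals
      rcases ih' with rfl | h' | h'
    · exact .inr (.inl h)
    · cases h; cases h'
    · obtain ⟨x, y, hxy⟩ := h
      obtain ⟨x', _, hxy'⟩ := h'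
      exact .inl (congrArg _ ((zip_inj_of_nodup hG hH hxy hxy').2 rfl))
    · exact .inr (.inr h)
    · obtain ⟨x, y, hxy⟩ := h
      obtain ⟨_, y', hxy'⟩ := h'
      exact .inl (congrArg _ ((zip_inj_of_nodup hG hH hxy hxy').1 rfl))
    · cases h; cases h'

theorem compInl_injective {G : OpenHypergraph S p q} {H : OpenHypergraph S q r}
    (hG : G.outputs.Nodup) (hH : H.inputs.Nodup) : Function.Injective (compInl G H) := by
  intro x y h
  rcases eq_or_glue_of_quot_eq hG hH h with h | h | h <;> cases h
  rfl

theorem compInr_injective {G : OpenHypergraph S p q} {H : OpenHypergraph S q r}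
    (hG : G.outputs.Nodup) (hH : H.inputs.Nodup) : Function.Injective (compInr G H) := by
  intro x y h
  rcases eq_or_glue_of_quot_eq hG hH h with h | h | h <;> cases h
  rfl

theorem compInl_eq_compInr_iff {G : OpenHypergraph S p q} {H : OpenHypergraph S q r}
    (hG : G.outputs.Nodup) (hH : H.inputs.Nodup) {x : G.Node} {y : H.Node} :
    compInl G H x = compInr G H y ↔ (x, y) ∈ G.outputs.zip H.inputs := by
  refine ⟨fun h => ?_, compGlue⟩
  rcases eq_or_glue_of_quot_eq hG hH h with h | h | h
  · cases h
  · obtain ⟨x, y, h⟩ := h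
    exact h
  · cases h

theorem exists_zip_of_mem_left {α β : Type*} {l : List α} {m : List β} (h : l.length = m.length)
    {x : α} (hx : x ∈ l) : ∃ y, (x, y) ∈ l.zip m := by
  rw [← List.map_fst_zip h.le] at hx
  obtain ⟨⟨x, y⟩, h, rfl⟩ := List.mem_map.1 hx
  exact ⟨y, h⟩

theorem exists_zip_of_mem_right {α β : Type*} {l : List α} {m : List β} (h : l.length = m.length)
    {y : β} (hy : y ∈ m) : ∃ x, (x, y) ∈ l.zip m := by
  rw [← List.map_snd_zip h.ge] at hy
  obtain ⟨⟨x, y⟩, h, rfl⟩ := List.mem_map.1 hy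
  exact ⟨x, h⟩

theorem length_outputs_eq_length_inputs (G : OpenHypergraph S p q) (H : OpenHypergraph S q r) :
    G.outputs.length = H.inputs.length :=
  (length_outputs G).trans (length_inputs H).symm

/-- The nodes of the composite are those of `G` together with the non-inputs of `H`, which are the
targets in `H`; they are also those of `H` together with the non-outputs of `G`, which are the
sources in `G`. The first description suits the inputs and targets, the second the outputs and
sources. -/
theorem Schedule.comp {G : OpenHypergraph S p q} {H : OpenHypergraph S q r}
    {es : List G.Edge} {key : G.Edge → ℕ} {es' : List H.Edge} {key' : H.Edge → ℕ}
    (hG : G.Schedule es key) (hH : H.Schedule es' key') :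
    ∃ es key, (G.comp H).Schedule es key := by
  have hlen := length_outputs_eq_length_inputs G H
  have hGo := hG.sources.nodup.of_append_left
  have hHi := hH.targets.nodup.of_append_left
  have hl := compInl_injective hGo hHi
  have hr := compInr_injective hGo hHi
  have hg {x y} : compInl G H x = compInr G H y ↔ _ := compInl_eq_compInr_iff hGo hHi
  have hGd := (List.nodup_append'.1 hG.sources.nodup).2.2
  have hHd := (List.nodup_append'.1 hH.targets.nodup).2.2
  obtain ⟨L, hL, htgt, hsrc⟩ : ∃ L : List (G.comp H).Edge, Enumerates L ∧
      L.flatMap (G.comp H).target =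
        (es.flatMap G.target).map (compInl G H) ++ (es'.flatMap H.target).map (compInr G H) ∧
      L.flatMap (G.comp H).source =
        (es.flatMap G.source).map (compInl G H) ++ (es'.flatMap H.source).map (compInr G H) :=
    ⟨_, hG.edges.sum hH.edges, flatMap_sumElim, flatMap_sumElim⟩
  have hin : (G.comp H).inputs = G.inputs.map (compInl G H) := rfl
  have hout : (G.comp H).outputs = H.outputs.map (compInr G H) := rfl
  classical
  -- The shift by the maximal rank in `G` plus one puts every hyperedge of `H` above all hyperedges
  -- of `G`.
  refine ⟨L, Sum.elim key fun e => es.toFinset.sup key + 1 + key' e, hL, ?_, ?_, ?_⟩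
  · rw [htgt, hin, ← List.append_assoc, ← List.map_append]
    constructor
    · refine List.nodup_append'.2 ⟨hG.targets.nodup.map hl,
        hH.targets.nodup.of_append_right.map hr, fun x h1 h2 => ?_⟩
      obtain ⟨x, -, rfl⟩ := List.mem_map.1 h1
      obtain ⟨y, hy, h⟩ := List.mem_map.1 h2
      exact hHd (List.of_mem_zip (hg.1 h.symm)).2 hy
    · have h1 (x : G.Node) : compInl G H x ∈ (G.inputs ++ es.flatMap G.target).map
          (compInl G H) ++ (es'.flatMap H.target).map (compInr G H) :=
        List.mem_append_left _ (List.mem_map_of_mem (hG.targets.mem x))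
      refine comp_cases h1 fun y => ?_
      rcases List.mem_append.1 (hH.targets.mem y) with hy | hy
      · obtain ⟨x, hx⟩ := exists_zip_of_mem_right hlen hy
        rw [← hg.2 hx]
        exact h1 x
      · exact List.mem_append_right _ (List.mem_map_of_mem hy)
  · rw [hsrc, hout]
    refine Enumerates.perm (l := (es.flatMap G.source).map (compInl G H) ++
      (H.outputs ++ es'.flatMap H.source).map (compInr G H)) ?_ ?_
    · constructor
      · refine List.nodup_append'.2 ⟨hG.sources.nodup.of_append_right.map hl,
          hH.sources.nodup.map hr, fun x h1 h2 => ?_⟩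
        obtain ⟨x, hx, rfl⟩ := List.mem_map.1 h1
        obtain ⟨y, -, h⟩ := List.mem_map.1 h2
        exact hGd (List.of_mem_zip (hg.1 h.symm)).1 hx
      · have h1 (y : H.Node) : compInr G H y ∈ (es.flatMap G.source).map (compInl G H) ++
            (H.outputs ++ es'.flatMap H.source).map (compInr G H) :=
          List.mem_append_right _ (List.mem_map_of_mem (hH.sources.mem y))
        refine comp_cases (fun x => ?_) h1
        rcases List.mem_append.1 (hG.sources.mem x) with hx | hx
        · obtain ⟨y, hy⟩ := exists_zip_of_mem_left hlen hx
          rw [hg.2 hy]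
          exact h1 y
        · exact List.mem_append_left _ (List.mem_map_of_mem hx)
    · rw [List.map_append, ← List.append_assoc, ← List.append_assoc]
      exact List.Perm.append_right _ List.perm_append_comm
  · have hsup (e) : key e ≤ es.toFinset.sup key :=
      Finset.le_sup (List.mem_toFinset.2 (hG.edges.mem e))
    rintro (e | e) (f | f) x he hf <;> obtain ⟨y, hy, rfl⟩ := List.mem_map.1 he <;>
      obtain ⟨z, hz, h⟩ := List.mem_map.1 hf
    · obtain rfl := hl h
      exact hG.rank e f _ hy hz
    · have := hsup e
      simp only [Sum.elim_inl, Sum.elim_inr]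
      omega
    -- No hyperedge of `H` feeds one of `G`: the shared node would be both an output and a source in
    -- `G`.
    · exact (hGd (List.of_mem_zip (hg.1 h)).1
        (List.mem_flatMap.2 ⟨f, hG.edges.mem f, hz⟩)).elim
    · obtain rfl := hr h
      simpa using hH.rank e f _ hy hz

end OpenHypergraph

/-! ### Interpretations of terms have schedules. -/

theorem SigTerm.exists_schedule_interp {S : Signature.{u, v}} {p q : List S.Obj}
    (c : SigTerm S p q) : ∃ es key, c.interp.Schedule es key := by
  induction c with
  | op d => exact ⟨_, _, OpenHypergraph.schedule_ofOp d⟩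
  | id x =>
    have h : Enumerates [()] := ⟨List.nodup_singleton _, fun _ => List.mem_singleton.2 rfl⟩
    exact ⟨_, _, OpenHypergraph.schedule_of_isEmpty ⟨Empty.elim⟩ h h⟩
  | symm x y =>
    exact ⟨_, _, OpenHypergraph.schedule_of_isEmpty ⟨Empty.elim⟩
      (show Enumerates [false, true] from ⟨by decide, by decide⟩)
      (show Enumerates [true, false] from ⟨by decide, by decide⟩)⟩
  | null =>
    have h : Enumerates ([] : List Empty) := ⟨List.nodup_nil, fun e => e.elim⟩
    exact ⟨_, _, OpenHypergraph.schedule_of_isEmpty ⟨Empty.elim⟩ h h⟩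
  | comp c d ih ih' =>
    obtain ⟨_, _, h⟩ := ih
    obtain ⟨_, _, h'⟩ := ih'
    exact h.comp h'
  | tensor c d ih ih' =>
    obtain ⟨_, _, h⟩ := ih
    obtain ⟨_, _, h'⟩ := ih'
    exact ⟨_, _, h.tensor h'⟩

/-! ### Recognising sequential composites. -/

namespace OpenHypergraph

variable {S : Signature.{u, v}} {p q r p' q' p₁ p₂ q₁ q₂ : List S.Obj}

/-- An isomorphism preserves labels, and the labels of the interfaces spell the type. Terms can thus
be found at unspecified types first, which avoids casts. -/
theorem Iso.type_eq {G : OpenHypergraph S p q} {H : OpenHypergraph S p' q'} (h : Iso G H) :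
    p = p' ∧ q = q' := by
  obtain ⟨φ, ψ, h1, -, -, -, h5, h6⟩ := h
  have e1 := H.inputs_label
  have e2 := H.outputs_label
  rw [h5, List.map_map, show H.nodeLabel ∘ φ = G.nodeLabel from funext h1, G.inputs_label] at e1
  rw [h6, List.map_map, show H.nodeLabel ∘ φ = G.nodeLabel from funext h1, G.outputs_label] at e2
  exact ⟨e1, e2⟩

theorem eq_of_mem_zip {α β γ : Type*} {l : List α} {m : List β} {f : α → γ} {g : β → γ}
    (hfg : l.map f = m.map g) {x : α} {y : β} (h : (x, y) ∈ l.zip m) : f x = g y := by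
  have h' := mem_zip_map f g h
  rw [hfg, List.zip_eq_zipWith, List.zipWith_self] at h'
  obtain ⟨z, -, h'⟩ := List.mem_map.1 h'
  simp only [Prod.mk.injEq] at h'
  exact h'.1.symm.trans h'.2

/-- A criterion for `K` to be the composite of `G` and `H`, whose nodes are embedded in those
of `K`. -/
theorem comp_iso_of_injective {G : OpenHypergraph S p q} {H : OpenHypergraph S q r}
    {K : OpenHypergraph S p' q'} {i : G.Node → K.Node} {j : H.Node → K.Node}
    {k : G.Edge → K.Edge} {l : H.Edge → K.Edge} (hi : Function.Injective i)
    (hj : Function.Injective j) (hij : G.outputs.map i = H.inputs.map j)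
    (hmem : ∀ x y, i x = j y → x ∈ G.outputs) (hsurj : ∀ z, (∃ x, i x = z) ∨ ∃ y, j y = z)
    (hkl : Function.Bijective (Sum.elim k l))
    (hiL : ∀ x, K.nodeLabel (i x) = G.nodeLabel x) (hjL : ∀ x, K.nodeLabel (j x) = H.nodeLabel x)
    (hkL : ∀ e, K.edgeLabel (k e) = G.edgeLabel e) (hlL : ∀ e, K.edgeLabel (l e) = H.edgeLabel e)
    (hks : ∀ e, K.source (k e) = (G.source e).map i)
    (hls : ∀ e, K.source (l e) = (H.source e).map j)
    (hkt : ∀ e, K.target (k e) = (G.target e).map i)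
    (hlt : ∀ e, K.target (l e) = (H.target e).map j)
    (hin : K.inputs = G.inputs.map i) (hout : K.outputs = H.outputs.map j) :
    Iso (G.comp H) K := by
  have hlen := length_outputs_eq_length_inputs G H
  have hzip {x y} (h : (x, y) ∈ G.outputs.zip H.inputs) : i x = j y := eq_of_mem_zip hij h
  let f : (G.comp H).Node → K.Node := compDesc i j fun x y h => hzip h
  have hf : Function.Bijective f := by
    constructor
    -- By `hmem` the node `x` is an output, so it is glued to some `y'`; then `j y' = i x = j y`,
    -- and injectivity of `j` gives `y' = y`.
    · have hlr (x : G.Node) (y : H.Node) (h : i x = j y) : compInl G H x = compInr G H y := by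
        obtain ⟨y', hy'⟩ := exists_zip_of_mem_left hlen (hmem x y h)
        obtain rfl : y = y' := hj (h.symm.trans (hzip hy'))
        exact compGlue hy'
      refine comp_cases (fun x => ?_) fun x => ?_ <;>
        refine comp_cases (fun y h => ?_) fun y h => ?_
      · exact congrArg _ (hi h)
      · exact hlr x y h
      · exact (hlr y x h.symm).symm
      · exact congrArg _ (hj h)
    · intro z
      rcases hsurj z with ⟨x, rfl⟩ | ⟨y, rfl⟩
      exacts [⟨compInl G H x, rfl⟩, ⟨compInr G H y, rfl⟩]
  refine ⟨.ofBijective f hf, .ofBijective _ hkl, comp_cases hiL hjL, ?_, ?_, ?_, ?_, ?_⟩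
  · rintro (e | e)
    exacts [hkL e, hlL e]
  · rintro (e | e)
    exacts [(hks e).trans (map_eq_map fun _ => rfl), (hls e).trans (map_eq_map fun _ => rfl)]
  · rintro (e | e)
    exacts [(hkt e).trans (map_eq_map fun _ => rfl), (hlt e).trans (map_eq_map fun _ => rfl)]
  · exact hin.trans (map_eq_map fun _ => rfl)
  · exact hout.trans (map_eq_map fun _ => rfl)

/-! ### Wirings: permutations as terms. -/

/-- `D` has no hyperedges, each of its nodes is both an input and an output, and `φ` sends the
inputs to `l` and the outputs to `m`. -/
structure IsWiring {α : Type*} (D : OpenHypergraph S p q) (φ : D.Node → α) (l m : List α) :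
    Prop where
  edge : IsEmpty D.Edge
  mem_inputs : ∀ x, x ∈ D.inputs
  mem_outputs : ∀ x, x ∈ D.outputs
  map_inputs : D.inputs.map φ = l
  map_outputs : D.outputs.map φ = m

theorem IsWiring.nodeLabel_eq {α : Type*} {label : α → S.Obj} {l m : List α}
    {D : OpenHypergraph S (l.map label) q} {φ : D.Node → α} (hD : D.IsWiring φ l m) (x : D.Node) :
    label (φ x) = D.nodeLabel x := by
  have h : D.inputs.map (label ∘ φ) = D.inputs.map D.nodeLabel := by
    rw [← List.map_map, hD.map_inputs, D.inputs_label]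
  exact List.map_inj_left.1 h x (hD.mem_inputs x)

theorem IsWiring.tensor {α : Type*} {D : OpenHypergraph S p₁ q₁} {E : OpenHypergraph S p₂ q₂}
    {φ : D.Node → α} {ψ : E.Node → α} {l m l' m' : List α} (hD : D.IsWiring φ l m)
    (hE : E.IsWiring ψ l' m') :
    (D.tensor E).IsWiring (Sum.elim φ ψ : D.Node ⊕ E.Node → α) (l ++ l') (m ++ m') where
  edge := by
    have := hD.edge
    have := hE.edge
    exact inferInstanceAs (IsEmpty (D.Edge ⊕ E.Edge))
  mem_inputs := by
    rintro (x | x)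
    exacts [List.mem_append_left _ (List.mem_map_of_mem (hD.mem_inputs x)),
      List.mem_append_right _ (List.mem_map_of_mem (hE.mem_inputs x))]
  mem_outputs := by
    rintro (x | x)
    exacts [List.mem_append_left _ (List.mem_map_of_mem (hD.mem_outputs x)),
      List.mem_append_right _ (List.mem_map_of_mem (hE.mem_outputs x))]
  map_inputs := by
    rw [← hD.map_inputs, ← hE.map_inputs]
    exact List.map_append.trans (congrArg₂ _ (List.map_map ..) (List.map_map ..))
  map_outputs := by
    rw [← hD.map_outputs, ← hE.map_outputs]
    exact List.map_append.trans (congrArg₂ _ (List.map_map ..) (List.map_map ..))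

/-- `φ` and `ψ` agree on glued nodes since both read the middle interface as `m`, so they descend to
the pushout. Every node of `D` is glued to one of `E` and conversely, so all nodes remain inputs and
outputs. -/
theorem IsWiring.comp {α : Type} {D : OpenHypergraph S p q} {E : OpenHypergraph S q r}
    {φ : D.Node → α} {ψ : E.Node → α} {l m n : List α} (hD : D.IsWiring φ l m)
    (hE : E.IsWiring ψ m n) : ∃ χ, (D.comp E).IsWiring χ l n := by
  have hlen := length_outputs_eq_length_inputs D E
  refine ⟨compDesc φ ψ fun x y => eq_of_mem_zip (hD.map_outputs.trans hE.map_inputs.symm), ?_,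
    ?_, ?_, ?_, ?_⟩
  · have := hD.edge
    have := hE.edge
    exact inferInstanceAs (IsEmpty (D.Edge ⊕ E.Edge))
  · have h (x) : compInl D E x ∈ (D.comp E).inputs :=
      List.mem_map_of_mem (f := compInl D E) (hD.mem_inputs x)
    refine comp_cases h fun y => ?_
    obtain ⟨x, hx⟩ := exists_zip_of_mem_right hlen (hE.mem_inputs y)
    rw [← compGlue hx]
    exact h x
  · have h (y) : compInr D E y ∈ (D.comp E).outputs :=
      List.mem_map_of_mem (f := compInr D E) (hE.mem_outputs y)
    refine comp_cases (fun x => ?_) h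
    obtain ⟨y, hy⟩ := exists_zip_of_mem_left hlen (hD.mem_outputs x)
    rw [compGlue hy]
    exact h y
  · exact (List.map_map ..).trans hD.map_inputs
  · exact (List.map_map ..).trans hE.map_outputs

theorem isWiring_ofId {α : Type*} (x : S.Obj) (a : α) :
    (ofId x).IsWiring (fun _ => a) [a] [a] where
  edge := ⟨Empty.elim⟩
  mem_inputs _ := List.mem_singleton.2 rfl
  mem_outputs _ := List.mem_singleton.2 rfl
  map_inputs := rfl
  map_outputs := rfl

theorem isWiring_ofSymm {α : Type*} (x y : S.Obj) (a b : α) :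
    (ofSymm x y).IsWiring (fun i : Bool => bif i then b else a) [a, b] [b, a] where
  edge := ⟨Empty.elim⟩
  mem_inputs := show ∀ i : Bool, i ∈ [false, true] by decide
  mem_outputs := show ∀ i : Bool, i ∈ [true, false] by decide
  map_inputs := rfl
  map_outputs := rfl

theorem isWiring_ofNull {α : Type*} : (ofNull (S := S)).IsWiring Empty.elim ([] : List α) [] where
  edge := ⟨Empty.elim⟩
  mem_inputs x := x.elim
  mem_outputs x := x.elim
  map_inputs := rfl
  map_outputs := rfl

theorem exists_isWiring_refl {α : Type} (label : α → S.Obj) (l : List α) :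
    ∃ (c : SigTerm S (l.map label) (l.map label)) (φ : _), c.interp.IsWiring φ l l := by
  induction l with
  | nil => exact ⟨.null, _, isWiring_ofNull⟩
  | cons a l ih =>
    obtain ⟨c, φ, h⟩ := ih
    exact ⟨.tensor (.id (label a)) c, _, (isWiring_ofId (label a) a).tensor h⟩

/-- Every permutation is realized by a term. -/
theorem exists_isWiring_of_perm {α : Type} (label : α → S.Obj) {l m : List α} (h : l.Perm m) :
    ∃ (c : SigTerm S (l.map label) (m.map label)) (φ : _), c.interp.IsWiring φ l m := by
  -- The constructors of `List.Perm` match the term constructors: `cons` adds an identity wire,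
  -- `swap` is a symmetry beside identities, `trans` is sequential composition.
  induction h with
  | nil => exact exists_isWiring_refl label []
  | cons a h ih =>
    obtain ⟨c, φ, h⟩ := ih
    exact ⟨.tensor (.id (label a)) c, _, (isWiring_ofId (label a) a).tensor h⟩
  | swap a b l =>
    obtain ⟨c, φ, h⟩ := exists_isWiring_refl label l
    exact ⟨.tensor (.symm (label b) (label a)) c, _,
      (isWiring_ofSymm (label b) (label a) b a).tensor h⟩
  | trans _ _ ih ih' =>
    obtain ⟨c, φ, h⟩ := ih
    obtain ⟨c', φ', h'⟩ := ih'
    exact ⟨.comp c c', h.comp h'⟩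

/-! ### Reconstructing a term from a schedule. -/

/-- `G` is isomorphic to the interpretation of a term. -/
def IsTermLike (G : OpenHypergraph S p q) : Prop :=
  ∃ (p' q' : List S.Obj) (c : SigTerm S p' q'), Iso c.interp G

theorem IsTermLike.exists_term {G : OpenHypergraph S p q} (h : G.IsTermLike) :
    ∃ c : SigTerm S p q, Iso c.interp G := by
  obtain ⟨p', q', c, h⟩ := h
  obtain ⟨rfl, rfl⟩ := h.type_eq
  exact ⟨c, h⟩

/-- Precomposing with the wiring of the permutation changes only the inputs, and turns `l` back into
`G.inputs`. -/
theorem IsTermLike.of_withInputs {G : OpenHypergraph S p q} {l : List G.Node}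
    (hl : G.inputs.Perm l) (h : (G.withInputs l).IsTermLike) : G.IsTermLike := by
  obtain ⟨c, hc⟩ := h.exists_term
  obtain ⟨d, φ, hd⟩ := exists_isWiring_of_perm G.nodeLabel hl
  refine ⟨_, _, .comp d c, ((Iso.refl _).comp hc).trans ((comp_iso_withInputs d.interp
    (G.withInputs l) hd.edge hd.mem_outputs φ hd.map_outputs).trans
    ⟨Equiv.refl _, Equiv.refl _, fun _ => rfl, fun _ => rfl, fun _ => (List.map_id _).symm,
      fun _ => (List.map_id _).symm, ?_, (List.map_id _).symm⟩)⟩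
  exact hd.map_inputs.symm.trans (List.map_id _).symm

/-- Inputs and outputs enumerate the same nodes, so a permutation wiring relates them. It is
isomorphic to `G` because its inputs, all of its nodes, are sent without repetition onto the nodes
of `G`. -/
theorem isTermLike_of_isEmpty {G : OpenHypergraph S p q} (he : IsEmpty G.Edge)
    (hi : Enumerates G.inputs) (ho : Enumerates G.outputs) : G.IsTermLike := by
  obtain ⟨d, φ, hd⟩ := exists_isWiring_of_perm G.nodeLabel
    ((List.perm_ext_iff_of_nodup hi.nodup ho.nodup).2 fun x => by simp [hi.mem, ho.mem])
  have hφ : Function.Bijective φ := by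
    refine ⟨Enumerates.injective_of_nodup_map hd.mem_inputs (hd.map_inputs.symm ▸ hi.nodup),
      fun x => ?_⟩
    obtain ⟨y, -, hy⟩ := List.mem_map.1 (hd.map_inputs.symm ▸ hi.mem x)
    exact ⟨y, hy⟩
  have := hd.edge
  exact ⟨_, _, d, .ofBijective φ hφ, Equiv.equivOfIsEmpty _ _, hd.nodeLabel_eq, fun e => this.elim e,
    fun e => this.elim e, fun e => this.elim e, hd.map_inputs.symm, hd.map_outputs.symm⟩

/-- The sub-hypergraph of `G` on the nodes in `P` and the hyperedges in `Q`, with interfaces `i`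
and `o`. -/
def restrict (G : OpenHypergraph S p q) (P : G.Node → Prop) (Q : G.Edge → Prop)
    (hs : ∀ e, Q e → ∀ x ∈ G.source e, P x) (ht : ∀ e, Q e → ∀ x ∈ G.target e, P x)
    {i o : List G.Node} (hi : ∀ x ∈ i, P x) (ho : ∀ x ∈ o, P x)
    (hp : i.map G.nodeLabel = p') (hq : o.map G.nodeLabel = q') : OpenHypergraph S p' q' where
  Node := {x // P x}
  Edge := {e // Q e}
  finite_node := by
    have := G.finite_node
    infer_instance
  finite_edge := by
    have := G.finite_edge
    infer_instance
  nodeLabel x := G.nodeLabel x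
  edgeLabel e := G.edgeLabel e
  source e := (G.source e).attachWith P (hs e e.2)
  target e := (G.target e).attachWith P (ht e e.2)
  source_label e := by simpa using G.source_label e
  target_label e := by simpa using G.target_label e
  inputs := i.attachWith P hi
  outputs := o.attachWith P ho
  inputs_label := by simpa using hp
  outputs_label := by simpa using hq

/-- The nodes of `ofOp` are positions in the arity or coarity, whose lengths agree with those of
`G.source e` and `G.target e` only propositionally; hence the `Fin.cast`. -/
theorem nodeLabel_get_cast {α β : Type*} {f : α → β} {l : List α} {m : List β} (h : l.map f = m)
    (hl : m.length = l.length) (i : Fin m.length) : f (l.get (i.cast hl)) = m.get i := by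
  subst h
  simp

theorem map_get_cast_finRange {α : Type*} {l : List α} {n : ℕ} (h : n = l.length) :
    (List.finRange n).map (fun i => l.get (i.cast h)) = l := by
  subst h
  simp

theorem Schedule.withInputs {G : OpenHypergraph S p q} {es : List G.Edge} {key : G.Edge → ℕ}
    (h : G.Schedule es key) {l : List G.Node} (hl : G.inputs.Perm l) :
    (G.withInputs l).Schedule es key where
  edges := h.edges
  targets := h.targets.perm (hl.append_right _)
  sources := h.sources
  rank := h.rank

/-- A hyperedge whose sources are inputs can be split off. -/
theorem IsTermLike.of_restrict {G : OpenHypergraph S p q} {e : G.Edge} {rest : List G.Node}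
    (hin : G.inputs = G.source e ++ rest)
    (hnodup : (G.source e ++ G.target e ++ rest).Nodup)
    (hs : ∀ f, f ≠ e → ∀ x ∈ G.source f, x ∉ G.source e)
    (ht : ∀ f, f ≠ e → ∀ x ∈ G.target f, x ∉ G.source e)
    (hi : ∀ x ∈ G.target e ++ rest, x ∉ G.source e) (ho : ∀ x ∈ G.outputs, x ∉ G.source e)
    (h : (G.restrict (· ∉ G.source e) (· ≠ e) hs ht hi ho rfl rfl).IsTermLike) :
    G.IsTermLike := by
  have hp : (G.target e ++ rest).map G.nodeLabel =
      S.coarity (G.edgeLabel e) ++ rest.map G.nodeLabel := by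
    rw [List.map_append, G.target_label]
  let H := G.restrict (· ∉ G.source e) (· ≠ e) hs ht hi ho hp G.outputs_label
  -- `H` is the restriction in `h` with its input word spelled through the coarity of `e`, so that
  -- it composes with `T`. `Iso` sees only the underlying data, so `hc` applies to both.
  obtain ⟨c, hc⟩ : ∃ c : SigTerm S _ _, Iso c.interp H := by
    obtain ⟨p', q', c, hc⟩ := h
    exact IsTermLike.exists_term ⟨p', q', c, hc⟩
  obtain ⟨d, φ, hd⟩ := exists_isWiring_refl G.nodeLabel rest
  have hds := hd.edge
  have hls : (S.arity (G.edgeLabel e)).length = (G.source e).length := by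
    simp [← G.source_label]
  have hlt : (S.coarity (G.edgeLabel e)).length = (G.target e).length := by
    simp [← G.target_label]
  let a (k : Fin (S.arity (G.edgeLabel e)).length) : G.Node := (G.source e).get (k.cast hls)
  let b (k : Fin (S.coarity (G.edgeLabel e)).length) : G.Node := (G.target e).get (k.cast hlt)
  have ha : (List.finRange _).map a = G.source e := map_get_cast_finRange hls
  have hb : (List.finRange _).map b = G.target e := map_get_cast_finRange hlt
  -- The first layer: the operation of `e` beside identity wires on the remaining inputs.
  let T := (ofOp (G.edgeLabel e)).tensor d.interp
  let i : T.Node → G.Node := Sum.elim (Sum.elim a b) φ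
  have hTin : T.inputs.map i = G.source e ++ rest :=
    List.map_append.trans (congrArg₂ _ ((List.map_map ..).trans ((List.map_map ..).trans ha))
      ((List.map_map ..).trans hd.map_inputs))
  have hTout : T.outputs.map i = G.target e ++ rest :=
    List.map_append.trans (congrArg₂ _ ((List.map_map ..).trans ((List.map_map ..).trans hb))
      ((List.map_map ..).trans hd.map_outputs))
  have hval (l : List G.Node) (hl : ∀ x ∈ l, x ∉ G.source e) :
      l = (l.attachWith (· ∉ G.source e) hl).map Subtype.val := by simp
  have hiso : Iso (T.comp H) G := by
    refine comp_iso_of_injective (i := i) (j := Subtype.val)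
      (k := fun _ => e) (l := Subtype.val) ?_ Subtype.val_injective ?_ ?_ ?_ ?_ ?_
      (fun _ => rfl) ?_ (fun _ => rfl) ?_ ?_ ?_ ?_ ?_ ?_
    · have hl := ((Enumerates.finRange (S.arity (G.edgeLabel e)).length).sum
        (.finRange (S.coarity (G.edgeLabel e)).length)).mem
      refine Enumerates.injective_of_nodup_map
        (l := (((List.finRange _).map Sum.inl ++ (List.finRange _).map Sum.inr).map Sum.inl ++
          d.interp.inputs.map Sum.inr : List ((ofOp (G.edgeLabel e)).Node ⊕ d.interp.Node))) ?_ ?_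
      · rintro (x | x)
        exacts [List.mem_append_left _ (List.mem_map_of_mem (hl x)),
          List.mem_append_right _ (List.mem_map_of_mem (hd.mem_inputs x))]
      · have := hnodup
        rw [← ha, ← hb, ← hd.map_inputs] at this
        exact (List.map_append.trans (congrArg₂ _ ((List.map_map ..).trans (List.map_append.trans
          (congrArg₂ _ (List.map_map ..) (List.map_map ..)))) (List.map_map ..))).symm ▸ this
    · exact hTout.trans (hval _ hi)
    -- `T` and `H` overlap only in outputs of `T`: the sources of `e` were removed from `H`, and all
    -- other nodes of `T` are outputs.
    · rintro ((x | x) | x) y h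
      · refine (y.2 ?_).elim
        rw [← h]
        exact List.get_mem _ _
      · exact List.mem_append_left _ (List.mem_map_of_mem
          (List.mem_map_of_mem (List.mem_finRange x)))
      · exact List.mem_append_right _ (List.mem_map_of_mem (hd.mem_outputs x))
    · intro z
      by_cases hz : z ∈ G.source e
      · rw [← ha] at hz
        obtain ⟨k, -, hk⟩ := List.mem_map.1 hz
        exact .inl ⟨.inl (.inl k), hk⟩
      · exact .inr ⟨⟨z, hz⟩, rfl⟩
    · constructor
      · rintro (⟨⟨⟩ | x⟩ | x) (⟨⟨⟩ | y⟩ | y) h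
        all_goals first | exact hds.elim x | exact hds.elim y | skip
        · rfl
        · exact (y.2 h.symm).elim
        · exact (x.2 h).elim
        · exact congrArg _ (Subtype.ext h)
      · intro f
        by_cases hf : f = e
        · exact ⟨.inl (.inl ()), hf.symm⟩
        · exact ⟨.inr ⟨f, hf⟩, rfl⟩
    · rintro ((x | x) | x)
      exacts [nodeLabel_get_cast (G.source_label e) hls x,
        nodeLabel_get_cast (G.target_label e) hlt x, hd.nodeLabel_eq x]
    · rintro (_ | x)
      exacts [rfl, hds.elim x]
    · rintro (_ | x)
      exacts [ha.symm.trans (map_eq_map_map fun _ => rfl), hds.elim x]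
    · exact fun f : {f // f ≠ e} => hval _ (hs f f.2)
    · rintro (_ | x)
      exacts [hb.symm.trans (map_eq_map_map fun _ => rfl), hds.elim x]
    · exact fun f : {f // f ≠ e} => hval _ (ht f f.2)
    · exact hin.trans hTin.symm
    · exact hval _ ho
  exact ⟨_, _, .comp (.tensor (.op (G.edgeLabel e)) d) c, ((Iso.refl T).comp hc).trans hiso⟩

theorem Schedule.isTermLike {G : OpenHypergraph S p q} {es : List G.Edge} {key : G.Edge → ℕ}
    (h : G.Schedule es key) : G.IsTermLike := by
  induction hn : es.length generalizing p q G with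
  | zero =>
    obtain rfl := List.length_eq_zero_iff.1 hn
    exact isTermLike_of_isEmpty ⟨fun e => List.not_mem_nil (h.edges.mem e)⟩
      (by simpa using h.targets) (by simpa using h.sources)
  | succ n ih =>
    classical
    have := G.finite_edge
    have : Nonempty G.Edge := ⟨es.head (by rintro rfl; simp at hn)⟩
    obtain ⟨e, he⟩ := Finite.exists_min key
    obtain ⟨fs, hfs⟩ : ∃ fs, es.Perm (e :: fs) := ⟨_, List.perm_cons_erase (h.edges.mem e)⟩
    have hE := h.edges.perm hfs
    have hT := h.targets.perm ((hfs.flatMap_right _).append_left _)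
    have hS := h.sources.perm ((hfs.flatMap_right _).append_left _)
    rw [List.flatMap_cons] at hS hT
    -- A source of `e` that is not an input is a target of some `f`, whose rank would lie below the
    -- minimum.
    have hsub : G.source e ⊆ G.inputs := by
      intro x hx
      rcases List.mem_append.1 (h.targets.mem x) with hx' | hx'
      · exact hx'
      · obtain ⟨f, -, hf⟩ := List.mem_flatMap.1 hx'
        exact ((h.rank f e x hf hx).not_ge (he f)).elim
    have hse : (G.source e).Nodup := hS.nodup.of_append_right.of_append_left
    -- The sources of `e` have no duplicates, so they can be taken out of the inputs as a block,
    -- leaving `rest`.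
    obtain ⟨l, hl, hl'⟩ := List.subperm_of_subset hse hsub
    obtain ⟨rest, hrest⟩ := hl'.exists_perm_append
    have hperm : G.inputs.Perm (G.source e ++ rest) := hrest.trans (hl.append_right _)
    refine IsTermLike.of_withInputs hperm ?_
    -- With the sources of `e` in front, the tails of `hT'` and `hS'` enumerate the nodes that
    -- remain after removing them. These tails are the two lists of a schedule for the remainder,
    -- whose inputs are `G.target e ++ rest`.
    have hT' : Enumerates (G.source e ++ ((G.target e ++ rest) ++ fs.flatMap G.target)) := by
      refine hT.perm ((hperm.append_right _).trans ?_)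
      simp only [← List.append_assoc]
      refine List.Perm.append_right _ ?_
      simp only [List.append_assoc]
      exact List.Perm.append_left _ List.perm_append_comm
    have hS' : Enumerates (G.source e ++ (G.outputs ++ fs.flatMap G.source)) := by
      refine hS.perm ?_
      simp only [← List.append_assoc]
      exact List.Perm.append_right _ List.perm_append_comm
    have hTd := (List.nodup_append'.1 hT'.nodup).2.2
    have hSd := (List.nodup_append'.1 hS'.nodup).2.2
    have hmem {f} (hf : f ≠ e) : f ∈ fs := List.mem_of_ne_of_mem hf (hE.mem f)
    have hs (f) (hf : f ≠ e) (x) (hx : x ∈ G.source f) : x ∉ G.source e := fun hx' =>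
      hSd hx' (List.mem_append_right _ (List.mem_flatMap.2 ⟨f, hmem hf, hx⟩))
    have ht (f) (hf : f ≠ e) (x) (hx : x ∈ G.target f) : x ∉ G.source e := fun hx' =>
      hTd hx' (List.mem_append_right _ (List.mem_flatMap.2 ⟨f, hmem hf, hx⟩))
    have hi (x) (hx : x ∈ G.target e ++ rest) : x ∉ G.source e := fun hx' =>
      hTd hx' (List.mem_append_left _ hx)
    have ho (x) (hx : x ∈ G.outputs) : x ∉ G.source e := fun hx' =>
      hSd hx' (List.mem_append_left _ hx)
    refine IsTermLike.of_restrict (G := G.withInputs (G.source e ++ rest)) (e := e) rfl ?_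
      hs ht hi ho ?_
    · have := hT'.nodup
      rw [← List.append_assoc, ← List.append_assoc] at this
      exact this.of_append_left
    · have hfs' : ∀ f ∈ fs, f ≠ e := fun f hf => by
        rintro rfl
        exact (List.nodup_cons.1 hE.nodup).1 hf
      -- Forgetting the subtypes turns the lists of the remainder into lists of nodes of `G`, where
      -- `hT'` and `hS'` apply.
      have hflat (t : G.Edge → List G.Node) (ht : ∀ f, f ≠ e → ∀ x ∈ t f, x ∉ G.source e) :
          ((fs.attachWith (· ≠ e) hfs').flatMap fun f : {f // f ≠ e} =>
            (t f).attachWith (· ∉ G.source e) (ht f f.2)).map Subtype.val = fs.flatMap t := by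
        simp only [List.map_flatMap, List.attachWith_map_subtype_val]
        exact (List.flatMap_map Subtype.val t _).symm.trans
          (congrArg (List.flatMap t) (List.attachWith_map_subtype_val hfs'))
      refine ih (es := fs.attachWith (· ≠ e) hfs') (key := fun f : {f // f ≠ e} => key f) ⟨?_, ?_, ?_, ?_⟩ ?_
      · refine .of_map_val ?_ ?_
        · rw [List.attachWith_map_subtype_val]
          exact (List.nodup_cons.1 hE.nodup).2
        · rw [List.attachWith_map_subtype_val]
          exact fun f => hmem
      · have hlist := List.map_append.trans (congrArg₂ (· ++ ·)
          (List.attachWith_map_subtype_val hi) (hflat G.target ht))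
        refine Enumerates.of_map_val (P := (· ∉ G.source e)) (hlist.symm ▸ ?_) (hlist.symm ▸ ?_)
        · exact hT'.nodup.of_append_right
        · exact fun x hx => (List.mem_append.1 (hT'.mem x)).resolve_left hx
      · have hlist := List.map_append.trans (congrArg₂ (· ++ ·)
          (List.attachWith_map_subtype_val ho) (hflat G.source hs))
        refine Enumerates.of_map_val (P := (· ∉ G.source e)) (hlist.symm ▸ ?_) (hlist.symm ▸ ?_)
        · exact hS'.nodup.of_append_right
        · exact fun x hx => (List.mem_append.1 (hS'.mem x)).resolve_left hx
      · exact fun (f g : {f // f ≠ e}) (x : {x // x ∉ G.source e}) hf hg =>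
          h.rank f g x ((List.mem_attachWith ..).1 hf) ((List.mem_attachWith ..).1 hg)
      · exact List.length_attachWith.trans (Nat.succ.inj (hfs.length_eq.symm.trans hn))

end OpenHypergraph
end StringDiag

/-! ### The characterization theorem. -/

theorem mainTheorem1 (S : StringDiag.Signature) (p q : List S.Obj)
    (G : StringDiag.OpenHypergraph S p q) :
    G.toClass ∈ Set.range (StringDiag.StringDiagram.interp (S := S) (p := p) (q := q)) ↔
      G.Monogamous ∧ G.toHypergraph.Acyclic := by
  rw [← StringDiag.OpenHypergraph.exists_schedule_iff]
  constructor
  · rintro ⟨c, hc⟩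
    induction c using Quotient.inductionOn with
    | h c =>
      obtain ⟨_, _, h⟩ := c.exists_schedule_interp
      exact h.of_iso (Quotient.exact hc)
  · rintro ⟨_, _, h⟩
    obtain ⟨c, hc⟩ := h.isTermLike.exists_term
    exact ⟨Quotient.mk _ c, Quotient.sound hc⟩
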